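/- Let $K$ be a field, let $\mathcal D$ be a small $K$-linear category, and let $C$ be a finite dimensional $K$-coalgebra with comultiplication $\Delta(c)=c_1\otimes c_2$ (summation omitted) and counit $\varepsilon$. Let $(\mathcal D,C,\psi)$ be a right-right entwining structure, i.e. a family of $K$-linear maps $\psi_{XY}:C\otimes \mathrm{Hom}_{\mathcal D}(X,Y)\to \mathrm{Hom}_{\mathcal D}(X,Y)\otimes C$, written $\psi_{XY}(c\otimes f)=f_\psi\otimes c^\psi$, such that for all composable $f,g$ and all $c\in C$ $$(gf)_\psi\otimes c^\psi=g_\psi f_\psi\otimes {c^\psi}^\psi,\quad \varepsilon(c^\psi)f_\psi=\varepsilon(c)f,\quad f_\psi\otimes\Delta(c^\psi)={f_\psi}_\psi\otimes {c_1}^\psi\otimes {c_2}^\psi,\quad \psi_{XX}(c\otimes \mathrm{id}_X)=\mathrm{id}_X\otimes c .$$ Let $\mathrm{Mod}\text{-}\mathcal D$ be the category of $K$-linear functors $\mathcal D^{op}\to \mathrm{Vect}_K$. An entwined module is $\mathcal M\in \mathrm{Mod}\text{-}\mathcal D$ with a right $C$-comodule structure $m\mapsto m_0\otimes m_1$ on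 each $\mathcal M(X)$ such that $(\mathcal M(f)(m))_0\otimes(\mathcal M(f)(m))_1=\mathcal M(f_\psi)(m_0)\otimes {m_1}^\psi$ for all $f\in \mathrm{Hom}_{\mathcal D}(Y,X)$ and $m\in\mathcal M(X)$. Entwined modules, with the $C$-colinear morphisms of $\mathcal D$-modules, form a category $\mathscr M(\psi)^C_{\mathcal D}$. Let $\mathscr F:\mathscr M(\psi)^C_{\mathcal D}\to \mathrm{Mod}\text{-}\mathcal D$ forget the coaction, and let $\mathscr G:\mathrm{Mod}\text{-}\mathcal D\to\mathscr M(\psi)^C_{\mathcal D}$, $\mathscr G(\mathcal N)=\mathcal N\otimes C$, with action $(\mathcal N\otimes C)(f)(n\otimes c)=\mathcal N(f_\psi)(n)\otimes c^\psi$ and coaction $n\otimes c\mapsto n\otimes c_1\otimes c_2$; it is a right adjoint of $\mathscr F$. The pair $(\mathscr F,\mathscr G)$ is a Frobenius pair if $\mathscr G$ is both a right and a left adjoint of $\mathscr F$. For $Y\in\mathcal D$ put $\mathbf h_Y=\mathrm{Hom}_{\mathcal D}(-,Y)$. The functor $h\otimes C:\mathcal D\to\mathscr M(\psi)^C_{\mathcal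 D}$ sends $Y$ to $\mathbf h_Y\otimes C=\mathscr G(\mathbf h_Y)$, and $f$ to $g\otimes c\mapsto fg\otimes c$. Let $(d_i)_{i=1}^k$ be a basis of $C$ with dual basis $(d_i^*)$, and let $\bullet$ be the convolution product of $C^*$. The functor $C^*\otimes h:\mathcal D\to\mathscr M(\psi)^C_{\mathcal D}$ sends $Y$ to $C^*\otimes\mathbf h_Y$, with action $(c^*\otimes g)\cdot f=c^*\otimes gf$ and coaction $c^*\otimes g\mapsto\sum_i (d_i^*\bullet c^*)\otimes g_\psi\otimes d_i^\psi$, and sends $f$ to $c^*\otimes g\mapsto\sum_i c^*(d_i^\psi)\,d_i^*\otimes f_\psi g$. Let $V_1$ be the space of families of $K$-linear maps $\theta_X:C\otimes C\to \mathrm{End}_{\mathcal D}(X)$, $X\in\mathcal D$, such that $\theta_X(c\otimes d)\circ f={f_\psi}_\psi\circ\theta_Y(c^\psi\otimes d^\psi)$ for all $f\in\mathrm{Hom}_{\mathcal D}(Y,X)$ and $\theta_X(c\otimes d_1)\otimes d_2=(\theta_X(c_2\otimes d))_\psi\otimes {c_1}^\psi$, for all $c,d\in C$. Let $W_1=\mathrm{Nat}(h,h\otimes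 C)$ be the space of morphisms of $\mathcal D$-$\mathcal D$-bimodules, where $h(X,Y)=\mathrm{Hom}_{\mathcal D}(X,Y)$; for $\eta\in W_1$ write $\eta(Y,Y)(\mathrm{id}_Y)=\sum a_Y\otimes c_Y$. For $\eta \in W_1$ and $\theta\in V_1$ let $\gamma'(\eta)=\Phi:C^*\otimes h\to h\otimes C$ and $\alpha'(\theta)=\Upsilon:h\otimes C\to C^*\otimes h$ be the natural transformations given, for $f\in\mathbf h_Y(X)$, $c^*\in C^*$ and $d\in C$, by $$\Phi_{XY}(c^*\otimes f)=\sum a_Yf_\psi\otimes c^*(c_{Y_2})\,{c_{Y_1}}^\psi,\qquad \Upsilon_{XY}(f\otimes d)=\sum_{i=1}^k d_i^*\otimes f_\psi\circ\theta_X(d_i^\psi\otimes d).$$ Then the following statements are equivalent: (i) $(\mathscr F,\mathscr G)$ is a Frobenius pair. (ii) There exist $\eta\in W_1$ and $\theta\in V_1$ such that $\Phi=\gamma'(\eta)$ and $\Upsilon=\alpha'(\theta)$ are inverses of each other. (iii) $C^*\otimes h$ and $h\otimes C$ are isomorphic as functors $\mathcal D\to\mathscr M(\psi)^C_{\mathcal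 D}$. -/

import Mathlib

open CategoryTheory Opposite TensorProduct

universe w u

set_option linter.unusedSectionVars false

noncomputable section

namespace Entwining

variable {K : Type u} [Field K] {D : Type w} [Category.{u} D] [Preadditive D] [Linear K D]
  {C : Type u} [AddCommGroup C] [Module K C] [Coalgebra K C]

/-! ### Right modules over a `K`-linear category -/

/-- Contravariant functors from `D` to vector spaces which are `K`-linear. -/
def IsLinearPresheaf (K : Type u) [Field K] (D : Type w) [Category.{u} D] [Preadditive D]
    [Linear K D] : ObjectProperty (Dᵒᵖ ⥤ ModuleCat.{u} K) := fun N =>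
  (∀ (X Y : D) (f g : X ⟶ Y), N.map (f + g).op = N.map f.op + N.map g.op) ∧
    ∀ (X Y : D) (r : K) (f : X ⟶ Y), N.map (r • f).op = r • N.map f.op

/-- The category `Mod-D` of right `D`-modules: `K`-linear functors `Dᵒᵖ ⥤ Vect_K`
and natural transformations. -/
abbrev RightMod (K : Type u) [Field K] (D : Type w) [Category.{u} D] [Preadditive D]
    [Linear K D] : Type _ := (IsLinearPresheaf K D).FullSubcategory

/-- The vector space `N(X)`. -/
abbrev RightMod.at (N : RightMod K D) (X : D) : ModuleCat.{u} K := N.obj.obj (op X)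

/-- The map `N(Y) → N(X)`, `n ↦ N(f)(n)`, for `f : X ⟶ Y`; it is linear in `f` too. -/
def RightMod.act (N : RightMod K D) {X Y : D} : (X ⟶ Y) →ₗ[K] N.at Y →ₗ[K] N.at X where
  toFun f := (N.obj.map f.op).hom
  map_add' f g := by rw [N.property.1]; rfl
  map_smul' r f := by rw [N.property.2]; rfl

/-- The component at `X` of a morphism of right `D`-modules. -/
abbrev RightMod.app {M N : RightMod K D} (η : M ⟶ N) (X : D) : M.at X →ₗ[K] N.at X :=
  (η.hom.app (op X)).hom

/-- A right module from a family of vector spaces with a bilinear, functorial right action. -/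
abbrev RightMod.ofAct (V : D → Type u) [∀ X, AddCommGroup (V X)] [∀ X, Module K (V X)]
    (act : ∀ {X Y : D}, (X ⟶ Y) →ₗ[K] V Y →ₗ[K] V X)
    (act_id : ∀ (X : D) (v : V X), act (𝟙 X) v = v)
    (act_comp : ∀ {X Y Z : D} (f : X ⟶ Y) (g : Y ⟶ Z) (v : V Z),
      act (f ≫ g) v = act f (act g v)) : RightMod K D where
  obj :=
    { obj X := ModuleCat.of K (V X.unop)
      map f := ModuleCat.ofHom (act f.unop)
      map_id X := by ext v; exact act_id _ v
      map_comp f g := by ext v; exact act_comp g.unop f.unop v }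
  property := ⟨fun X Y f g => by ext v; simp, fun X Y r f => by ext v; simp⟩

/-- A morphism of right modules from a family of linear maps commuting with the actions. -/
abbrev RightMod.homOf {M N : RightMod K D} (η : ∀ X : D, M.at X →ₗ[K] N.at X)
    (nat : ∀ {X Y : D} (f : X ⟶ Y) (m : M.at Y), η X (M.act f m) = N.act f (η Y m)) :
    M ⟶ N :=
  ObjectProperty.homMk
    { app X := ModuleCat.ofHom (η X.unop)
      naturality X Y f := by ext m; exact nat f.unop m }

lemma RightMod.act_id (N : RightMod K D) {X : D} (n : N.at X) : N.act (𝟙 X) n = n := by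
  simp [RightMod.act]

lemma RightMod.act_comp (N : RightMod K D) {X Y Z : D} (f : X ⟶ Y) (g : Y ⟶ Z) (n : N.at Z) :
    N.act (f ≫ g) n = N.act f (N.act g n) := by
  simp [RightMod.act]

lemma RightMod.app_act {M N : RightMod K D} (η : M ⟶ N) {X Y : D} (f : X ⟶ Y) (m : M.at Y) :
    app η X (M.act f m) = N.act f (app η Y m) :=
  ConcreteCategory.congr_hom (η.hom.naturality f.op) m

/-- The functor `h : D ⥤ Mod-D`, `Y ↦ h_Y = Hom_D(-, Y)` (equivalently, the canonical
`D`-`D`-bimodule `h(X, Y) = Hom_D(X, Y)`). -/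
def h (K : Type u) [Field K] (D : Type w) [Category.{u} D] [Preadditive D] [Linear K D] :
    D ⥤ RightMod K D :=
  (IsLinearPresheaf K D).lift (linearYoneda K D) fun Y =>
    ⟨fun X X' f g => by ext (v : X' ⟶ Y); exact Preadditive.add_comp _ _ _ f g v,
      fun X X' r f => by ext (v : X' ⟶ Y); exact Linear.smul_comp _ _ _ r f v⟩

/-- Composition `g ⊗ f ↦ g ∘ f` as a linear map. -/
def compo (X Y Z : D) : (Y ⟶ Z) ⊗[K] (X ⟶ Y) →ₗ[K] (X ⟶ Z) :=
  TensorProduct.lift (Linear.comp X Y Z).flip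

@[simp] lemma compo_tmul {X Y Z : D} (g : Y ⟶ Z) (f : X ⟶ Y) :
    compo (K := K) X Y Z (g ⊗ₜ f) = f ≫ g := rfl

/-! ### Comodules and entwining structures -/

/-- A right `C`-comodule structure `ρ : M → M ⊗ C` on a vector space `M`. -/
structure RightCoaction (K : Type u) [Field K] (C : Type u) [AddCommGroup C] [Module K C]
    [Coalgebra K C] (M : Type u) [AddCommGroup M] [Module K M] where
  ρ : M →ₗ[K] M ⊗[K] C
  coassoc : ∀ m, TensorProduct.assoc K M C C (ρ.rTensor C (ρ m)) =
    (Coalgebra.comul (R := K) (A := C)).lTensor M (ρ m)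
  counit : ∀ m, TensorProduct.rid K M
    ((Coalgebra.counit (R := K) (A := C)).lTensor M (ρ m)) = m

/-- A (right-right) entwining structure `(D, C, ψ)`, `ψ(c ⊗ f) = f_ψ ⊗ c^ψ`. -/
structure EntwiningStructure (K : Type u) [Field K] (D : Type w) [Category.{u} D]
    [Preadditive D] [Linear K D] (C : Type u) [AddCommGroup C] [Module K C]
    [Coalgebra K C] where
  ψ : ∀ X Y : D, C ⊗[K] (X ⟶ Y) →ₗ[K] (X ⟶ Y) ⊗[K] C
  /-- `(gf)_ψ ⊗ c^ψ = g_ψ f_ψ ⊗ (c^ψ)^ψ`. -/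
  psi_comp : ∀ {X Y Z : D} (f : X ⟶ Y) (g : Y ⟶ Z) (c : C),
    ψ X Z (c ⊗ₜ (f ≫ g)) = (compo X Y Z).rTensor C
      ((TensorProduct.assoc K (Y ⟶ Z) (X ⟶ Y) C).symm
        ((ψ X Y ∘ₗ (TensorProduct.mk K C (X ⟶ Y)).flip f).lTensor (Y ⟶ Z) (ψ Y Z (c ⊗ₜ g))))
  /-- `ε(c^ψ) f_ψ = ε(c) f`. -/
  psi_counit : ∀ {X Y : D} (f : X ⟶ Y) (c : C),
    TensorProduct.rid K (X ⟶ Y)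
      ((Coalgebra.counit (R := K) (A := C)).lTensor (X ⟶ Y) (ψ X Y (c ⊗ₜ f))) =
      Coalgebra.counit (R := K) c • f
  /-- `f_ψ ⊗ Δ(c^ψ) = (f_ψ)_ψ ⊗ (c_1)^ψ ⊗ (c_2)^ψ`. -/
  psi_comul : ∀ {X Y : D} (f : X ⟶ Y) (c : C),
    (Coalgebra.comul (R := K) (A := C)).lTensor (X ⟶ Y) (ψ X Y (c ⊗ₜ f)) =
      TensorProduct.assoc K (X ⟶ Y) C C ((ψ X Y).rTensor C
        ((TensorProduct.assoc K C (X ⟶ Y) C).symm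
          ((ψ X Y ∘ₗ (TensorProduct.mk K C (X ⟶ Y)).flip f).lTensor C
            (Coalgebra.comul (R := K) c))))
  /-- `ψ(c ⊗ id) = id ⊗ c`. -/
  psi_id : ∀ (X : D) (c : C), ψ X X (c ⊗ₜ 𝟙 X) = 𝟙 X ⊗ₜ c

namespace EntwiningStructure

variable (E : EntwiningStructure K D C)

/-- `c ↦ f_ψ ⊗ c^ψ`, for a fixed `f`. -/
def psiR {X Y : D} (f : X ⟶ Y) : C →ₗ[K] (X ⟶ Y) ⊗[K] C :=
  E.ψ X Y ∘ₗ (TensorProduct.mk K C (X ⟶ Y)).flip f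

@[simp] lemma psiR_apply {X Y : D} (f : X ⟶ Y) (c : C) : E.psiR f c = E.ψ X Y (c ⊗ₜ f) := rfl

/-- For a bilinear `B : Hom(X, Y) × V → W`, the map `V ⊗ C → W ⊗ C`,
`v ⊗ c ↦ B(f_ψ, v) ⊗ c^ψ`, linear in `f`. -/
def twist {X Y : D} {V W : Type u} [AddCommGroup V] [Module K V] [AddCommGroup W] [Module K W]
    (B : (X ⟶ Y) →ₗ[K] V →ₗ[K] W) : (X ⟶ Y) →ₗ[K] V ⊗[K] C →ₗ[K] W ⊗[K] C where
  toFun f := (TensorProduct.lift B.flip).rTensor C ∘ₗ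
    (TensorProduct.assoc K V (X ⟶ Y) C).symm.toLinearMap ∘ₗ (E.psiR f).lTensor V
  map_add' f g := by ext v c; simp [tmul_add]
  map_smul' r f := by ext v c; simp

lemma twist_tmul {X Y : D} {V W : Type u} [AddCommGroup V] [Module K V] [AddCommGroup W]
    [Module K W] (B : (X ⟶ Y) →ₗ[K] V →ₗ[K] W) (f : X ⟶ Y) (v : V) (c : C) :
    E.twist B f (v ⊗ₜ c) = (B.flip v).rTensor C (E.ψ X Y (c ⊗ₜ f)) := by
  simp only [twist, LinearMap.coe_mk, AddHom.coe_mk, LinearMap.comp_apply,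
    LinearMap.lTensor_tmul, psiR_apply]
  induction E.ψ X Y (c ⊗ₜ f) with
  | zero => simp
  | add x y hx hy => simp only [tmul_add, map_add, hx, hy]
  | tmul g d => simp

lemma twist_natural {X Y : D} {V W V' W' : Type u} [AddCommGroup V] [Module K V]
    [AddCommGroup W] [Module K W] [AddCommGroup V'] [Module K V'] [AddCommGroup W'] [Module K W']
    (B : (X ⟶ Y) →ₗ[K] V →ₗ[K] W) (B' : (X ⟶ Y) →ₗ[K] V' →ₗ[K] W') (α : V →ₗ[K] V')
    (β : W →ₗ[K] W') (hB : ∀ f v, β (B f v) = B' f (α v)) (f : X ⟶ Y) (t : V ⊗[K] C) :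
    β.rTensor C (E.twist B f t) = E.twist B' f (α.rTensor C t) := by
  induction t with
  | zero => simp
  | add x y hx hy => simp only [map_add, hx, hy]
  | tmul v c =>
    rw [LinearMap.rTensor_tmul, twist_tmul, twist_tmul, ← LinearMap.comp_apply,
      ← LinearMap.rTensor_comp]
    congr 2
    ext g
    simp [hB]

lemma psi_comp' {X Y Z : D} (f : X ⟶ Y) (g : Y ⟶ Z) (c : C) :
    E.ψ X Z (c ⊗ₜ (f ≫ g)) = E.twist (Linear.comp X Y Z) f (E.ψ Y Z (c ⊗ₜ g)) :=
  E.psi_comp f g c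

lemma twist_id {X : D} {V : Type u} [AddCommGroup V] [Module K V]
    (B : (X ⟶ X) →ₗ[K] V →ₗ[K] V) (hB : ∀ v, B (𝟙 X) v = v) (t : V ⊗[K] C) :
    E.twist B (𝟙 X) t = t := by
  induction t with
  | zero => simp
  | add x y hx hy => simp only [map_add, hx, hy]
  | tmul v c => rw [twist_tmul, E.psi_id]; simp [hB]

lemma twist_comp {X Y Z : D} {V W U : Type u} [AddCommGroup V] [Module K V]
    [AddCommGroup W] [Module K W] [AddCommGroup U] [Module K U]
    (B : (Y ⟶ Z) →ₗ[K] V →ₗ[K] W) (B' : (X ⟶ Y) →ₗ[K] W →ₗ[K] U)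
    (B'' : (X ⟶ Z) →ₗ[K] V →ₗ[K] U) (hB : ∀ f g v, B'' (f ≫ g) v = B' f (B g v))
    (f : X ⟶ Y) (g : Y ⟶ Z) (t : V ⊗[K] C) :
    E.twist B'' (f ≫ g) t = E.twist B' f (E.twist B g t) := by
  induction t with
  | zero => simp
  | add x y hx hy => simp only [map_add, hx, hy]
  | tmul v c =>
    rw [twist_tmul, twist_tmul, psi_comp']
    exact E.twist_natural _ _ _ _ (fun f g => hB f g v) f _

end EntwiningStructure

/-! ### Entwined modules -/

/-- An entwined module: a right `D`-module `M` with right `C`-comodule structures on all `M(X)`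
such that `ρ(M(f)(m)) = M(f_ψ)(m_0) ⊗ (m_1)^ψ`. -/
structure EntwinedModule (E : EntwiningStructure K D C) where
  toMod : RightMod K D
  coact : ∀ X : D, RightCoaction K C (toMod.at X)
  compat : ∀ {X Y : D} (f : X ⟶ Y) (m : toMod.at Y),
    (coact X).ρ (toMod.act f m) = E.twist toMod.act f ((coact Y).ρ m)

/-- Morphisms of entwined modules: `C`-colinear morphisms of right `D`-modules. -/
@[ext]
structure EntwinedModule.Hom {E : EntwiningStructure K D C} (M N : EntwinedModule E) where
  hom : M.toMod ⟶ N.toMod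
  colinear : ∀ (X : D) (m : M.toMod.at X),
    (N.coact X).ρ (RightMod.app hom X m) =
      (RightMod.app hom X).rTensor C ((M.coact X).ρ m)

/-- The category of entwined modules over `(D, C, ψ)`. -/
instance (E : EntwiningStructure K D C) : Category (EntwinedModule E) where
  Hom := EntwinedModule.Hom
  id M :=
    { hom := 𝟙 M.toMod
      colinear X m := ((LinearMap.rTensor_id_apply C (M.toMod.at X) ((M.coact X).ρ m))).symm }
  comp {M N P} f g :=
    { hom := f.hom ≫ g.hom
      colinear X m := by
        refine (g.colinear X (RightMod.app f.hom X m)).trans ?_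
        rw [f.colinear X m, ← LinearMap.comp_apply, ← LinearMap.rTensor_comp]
        rfl }
  id_comp f := EntwinedModule.Hom.ext (Category.id_comp f.hom)
  comp_id f := EntwinedModule.Hom.ext (Category.comp_id f.hom)
  assoc f g k := EntwinedModule.Hom.ext (Category.assoc f.hom g.hom k.hom)

@[ext]
lemma EntwinedModule.hom_ext {E : EntwiningStructure K D C} {M N : EntwinedModule E}
    {f g : M ⟶ N} (hfg : f.hom = g.hom) : f = g := EntwinedModule.Hom.ext hfg

variable (E : EntwiningStructure K D C)

/-- The functor `F` forgetting the `C`-coaction. -/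
def forgetCoaction : EntwinedModule E ⥤ RightMod K D where
  obj M := M.toMod
  map f := f.hom

/-- The comodule structure `v ⊗ c ↦ v ⊗ c_1 ⊗ c_2` on `V ⊗ C`. -/
def freeCoaction (K : Type u) [Field K] (C : Type u) [AddCommGroup C] [Module K C]
    [Coalgebra K C] (V : Type u) [AddCommGroup V] [Module K V] :
    RightCoaction K C (V ⊗[K] C) where
  ρ := (TensorProduct.assoc K V C C).symm.toLinearMap ∘ₗ
    (Coalgebra.comul (R := K) (A := C)).lTensor V
  coassoc t := by
    induction t with
    | zero => simp
    | add x y hx hy => simp only [map_add, hx, hy]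
    | tmul v c =>
      have key : ∀ s : C ⊗[K] C,
          TensorProduct.assoc K (V ⊗[K] C) C C
            (((TensorProduct.assoc K V C C).symm.toLinearMap ∘ₗ
              (Coalgebra.comul (R := K) (A := C)).lTensor V).rTensor C
                ((TensorProduct.assoc K V C C).symm (v ⊗ₜ s))) =
          (TensorProduct.assoc K V C (C ⊗[K] C)).symm (v ⊗ₜ TensorProduct.assoc K C C C
            ((Coalgebra.comul (R := K) (A := C)).rTensor C s)) := by
        intro s
        induction s with
        | zero => simp
        | add x y hx hy => simp only [map_add, tmul_add, hx, hy]
        | tmul c d =>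
          simp only [assoc_symm_tmul, LinearMap.rTensor_tmul, LinearMap.comp_apply,
            LinearMap.lTensor_tmul, LinearEquiv.coe_coe]
          induction Coalgebra.comul (R := K) c with
          | zero => simp
          | add x y hx hy => simp only [map_add, tmul_add, add_tmul, hx, hy]
          | tmul a b => simp
      have key2 : ∀ s : C ⊗[K] C,
          (Coalgebra.comul (R := K) (A := C)).lTensor (V ⊗[K] C)
            ((TensorProduct.assoc K V C C).symm (v ⊗ₜ s)) =
          (TensorProduct.assoc K V C (C ⊗[K] C)).symm (v ⊗ₜ
            (Coalgebra.comul (R := K) (A := C)).lTensor C s) := by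
        intro s
        induction s with
        | zero => simp
        | add x y hx hy => simp only [map_add, tmul_add, hx, hy]
        | tmul c d => simp
      rw [LinearMap.comp_apply, LinearMap.lTensor_tmul]
      exact (key _).trans ((congrArg (fun s => (TensorProduct.assoc K V C (C ⊗[K] C)).symm
        (v ⊗ₜ s)) (Coalgebra.coassoc_apply c)).trans (key2 _).symm)
  counit t := by
    induction t with
    | zero => simp
    | add x y hx hy => simp only [map_add, hx, hy]
    | tmul v c =>
      have key : ∀ s : C ⊗[K] C, TensorProduct.rid K (V ⊗[K] C)
          ((Coalgebra.counit (R := K) (A := C)).lTensor (V ⊗[K] C)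
            ((TensorProduct.assoc K V C C).symm (v ⊗ₜ s))) =
          v ⊗ₜ TensorProduct.rid K C ((Coalgebra.counit (R := K) (A := C)).lTensor C s) := by
        intro s
        induction s with
        | zero => simp
        | add x y hx hy => simp only [map_add, tmul_add, hx, hy]
        | tmul c d => simp
      rw [LinearMap.comp_apply, LinearMap.lTensor_tmul]
      refine (key _).trans ?_
      rw [Coalgebra.lTensor_counit_comul, rid_tmul, one_smul]

lemma freeCoaction_compat {X Y : D} {V W : Type u} [AddCommGroup V] [Module K V]
    [AddCommGroup W] [Module K W] (B : (X ⟶ Y) →ₗ[K] V →ₗ[K] W) (f : X ⟶ Y) (t : V ⊗[K] C) :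
    (freeCoaction K C W).ρ (E.twist B f t) =
      E.twist (E.twist B) f ((freeCoaction K C V).ρ t) := by
  induction t with
  | zero => simp
  | add x y hx hy => simp only [map_add, hx, hy]
  | tmul v c =>
    rw [E.twist_tmul]
    simp only [freeCoaction, LinearMap.comp_apply, LinearMap.lTensor_tmul, LinearEquiv.coe_coe]
    have key : ∀ t : (X ⟶ Y) ⊗[K] C, (TensorProduct.assoc K W C C).symm
        ((Coalgebra.comul (R := K) (A := C)).lTensor W ((B.flip v).rTensor C t)) =
        (TensorProduct.assoc K W C C).symm ((B.flip v).rTensor (C ⊗[K] C)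
          ((Coalgebra.comul (R := K) (A := C)).lTensor (X ⟶ Y) t)) := by
      intro t
      rw [← LinearMap.comp_apply (LinearMap.lTensor _ _), ← LinearMap.comp_apply
        (LinearMap.rTensor _ _), LinearMap.lTensor_comp_rTensor, LinearMap.rTensor_comp_lTensor]
    rw [key, E.psi_comul]
    induction Coalgebra.comul (R := K) c with
    | zero => simp
    | add x y hx hy => simp only [map_add, tmul_add, hx, hy]
    | tmul c₁ c₂ =>
      simp only [LinearMap.lTensor_tmul, assoc_symm_tmul, E.twist_tmul]
      change _ = ((E.twist B).flip (v ⊗ₜ c₁)).rTensor C (E.psiR f c₂)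
      change (TensorProduct.assoc K W C C).symm ((B.flip v).rTensor (C ⊗[K] C)
        (TensorProduct.assoc K (X ⟶ Y) C C ((E.ψ X Y).rTensor C
          ((TensorProduct.assoc K C (X ⟶ Y) C).symm (c₁ ⊗ₜ E.psiR f c₂))))) = _
      induction E.psiR f c₂ with
      | zero => simp
      | add x y hx hy => simp only [map_add, tmul_add, hx, hy]
      | tmul g d =>
        simp only [assoc_symm_tmul, LinearMap.rTensor_tmul, LinearMap.flip_apply, E.twist_tmul]
        induction E.ψ X Y (c₁ ⊗ₜ g) with
        | zero => simp
        | add x y hx hy => simp only [map_add, add_tmul, hx, hy]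
        | tmul g' d' => simp

lemma freeCoaction_natural {V W : Type u} [AddCommGroup V] [Module K V]
    [AddCommGroup W] [Module K W] (α : V →ₗ[K] W) (t : V ⊗[K] C) :
    (freeCoaction K C W).ρ (α.rTensor C t) =
      (α.rTensor C).rTensor C ((freeCoaction K C V).ρ t) := by
  induction t with
  | zero => simp
  | add x y hx hy => simp only [map_add, hx, hy]
  | tmul v c =>
    simp only [freeCoaction, LinearMap.comp_apply, LinearMap.lTensor_tmul, LinearEquiv.coe_coe,
      LinearMap.rTensor_tmul]
    induction Coalgebra.comul (R := K) c with
    | zero => simp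
    | add x y hx hy => simp only [map_add, tmul_add, hx, hy]
    | tmul c d => simp

/-- The entwined module `N ⊗ C`, with action `(n ⊗ c) · f = N(f_ψ)(n) ⊗ c^ψ` and coaction
`n ⊗ c ↦ n ⊗ c_1 ⊗ c_2`. -/
def tensorC (N : RightMod K D) : EntwinedModule E where
  toMod := RightMod.ofAct (fun X => N.at X ⊗[K] C) (E.twist N.act)
    (fun _ t => E.twist_id _ N.act_id t)
    (fun f g t => E.twist_comp _ _ _ N.act_comp f g t)
  coact X := freeCoaction K C (N.at X)
  compat f t := freeCoaction_compat E N.act f t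

/-- The functor `G : N ↦ N ⊗ C`. -/
def cofree : RightMod K D ⥤ EntwinedModule E where
  obj N := tensorC E N
  map {M N} η :=
    { hom := RightMod.homOf (M := (tensorC E M).toMod) (N := (tensorC E N).toMod)
        (fun X => (RightMod.app η X).rTensor C)
        (fun f t => E.twist_natural _ _ _ _ (fun f m => RightMod.app_act η f m) f t)
      colinear X t := by
        exact freeCoaction_natural (RightMod.app η X) t }
  map_id N := by
    ext X t
    exact LinearMap.rTensor_id_apply C _ t
  map_comp f g := by
    ext X t
    exact LinearMap.rTensor_comp_apply C _ _ t

/-! ### The functors `h ⊗ C` and `C* ⊗ h` from `D` to entwined modules -/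

/-- The functor `h ⊗ C : D ⥤ M(ψ)`, `Y ↦ h_Y ⊗ C`, `f ↦ (g ⊗ c ↦ fg ⊗ c)`. -/
def hTensorC : D ⥤ EntwinedModule E := h K D ⋙ cofree E

lemma assoc_symm_mk {M N P : Type u} [AddCommGroup M] [Module K M] [AddCommGroup N] [Module K N]
    [AddCommGroup P] [Module K P] (m : M) (t : N ⊗[K] P) :
    (TensorProduct.assoc K M N P).symm (m ⊗ₜ t) = (TensorProduct.mk K M N m).rTensor P t := by
  induction t with
  | zero => simp
  | add x y hx hy => simp only [map_add, tmul_add, hx, hy]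
  | tmul c d => simp

/-- The right action `n ⊗ g ↦ n ⊗ gf` on `N ⊗ h_X`. -/
def comodAct (N : Type u) [AddCommGroup N] [Module K N] (X : D) {Z Y : D} :
    (Z ⟶ Y) →ₗ[K] N ⊗[K] (Y ⟶ X) →ₗ[K] N ⊗[K] (Z ⟶ X) where
  toFun f := (Linear.leftComp K X f).lTensor N
  map_add' f g := by ext n k; simp [tmul_add]
  map_smul' r f := by ext n k; simp

@[simp] lemma comodAct_tmul (N : Type u) [AddCommGroup N] [Module K N] (X : D) {Z Y : D}
    (f : Z ⟶ Y) (n : N) (g : Y ⟶ X) : comodAct N X f (n ⊗ₜ[K] g) = n ⊗ₜ (f ≫ g) := rfl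

/-- The map `n ⊗ g ↦ n_0 ⊗ g_ψ ⊗ (n_1)^ψ` on `N ⊗ h_X(Y)`. -/
def comodRho {N : Type u} [AddCommGroup N] [Module K N] (ρN : RightCoaction K C N) (X Y : D) :
    N ⊗[K] (Y ⟶ X) →ₗ[K] (N ⊗[K] (Y ⟶ X)) ⊗[K] C :=
  (TensorProduct.assoc K N (Y ⟶ X) C).symm.toLinearMap ∘ₗ (E.ψ Y X).lTensor N ∘ₗ
    (TensorProduct.assoc K N C (Y ⟶ X)).toLinearMap ∘ₗ ρN.ρ.rTensor (Y ⟶ X)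

lemma comodRho_tmul {N : Type u} [AddCommGroup N] [Module K N] (ρN : RightCoaction K C N)
    {X Y : D} (n : N) (g : Y ⟶ X) :
    comodRho E ρN X Y (n ⊗ₜ g) =
      (TensorProduct.assoc K N (Y ⟶ X) C).symm ((E.psiR g).lTensor N (ρN.ρ n)) := by
  simp only [comodRho, LinearMap.comp_apply, LinearMap.rTensor_tmul, LinearEquiv.coe_coe]
  congr 1
  induction ρN.ρ n with
  | zero => simp
  | add x y hx hy => simp only [map_add, add_tmul, hx, hy]
  | tmul m c => simp

lemma comodRho_compat {N : Type u} [AddCommGroup N] [Module K N] (ρN : RightCoaction K C N)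
    {X Y Z : D} (f : Z ⟶ Y) (t : N ⊗[K] (Y ⟶ X)) :
    comodRho E ρN X Z (comodAct N X f t) =
      E.twist (comodAct N X) f (comodRho E ρN X Y t) := by
  induction t with
  | zero => simp
  | add x y hx hy => simp only [map_add, hx, hy]
  | tmul n g =>
    rw [comodAct_tmul, comodRho_tmul, comodRho_tmul]
    induction ρN.ρ n with
    | zero => simp
    | add x y hx hy => simp only [map_add, hx, hy]
    | tmul m c =>
      simp only [LinearMap.lTensor_tmul, EntwiningStructure.psiR_apply, assoc_symm_mk]
      rw [E.psi_comp']
      exact E.twist_natural _ _ _ _ (fun f v => rfl) _ _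

/-- The comodule structure `n ⊗ g ↦ n_0 ⊗ g_ψ ⊗ (n_1)^ψ` on `N ⊗ h_X(Y)`, for a comodule `N`. -/
def comodCoaction {N : Type u} [AddCommGroup N] [Module K N] (ρN : RightCoaction K C N)
    (X Y : D) : RightCoaction K C (N ⊗[K] (Y ⟶ X)) where
  ρ := comodRho E ρN X Y
  coassoc t := by
    induction t with
    | zero => simp
    | add x y hx hy => simp only [map_add, hx, hy]
    | tmul n g =>
      have key : ∀ s : N ⊗[K] C,
          TensorProduct.assoc K (N ⊗[K] (Y ⟶ X)) C C ((comodRho E ρN X Y).rTensor C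
            ((TensorProduct.assoc K N (Y ⟶ X) C).symm ((E.psiR g).lTensor N s))) =
          (TensorProduct.assoc K N (Y ⟶ X) (C ⊗[K] C)).symm
            (((TensorProduct.assoc K (Y ⟶ X) C C).toLinearMap ∘ₗ (E.ψ Y X).rTensor C ∘ₗ
              (TensorProduct.assoc K C (Y ⟶ X) C).symm.toLinearMap ∘ₗ
              (E.psiR g).lTensor C).lTensor N
                (TensorProduct.assoc K N C C (ρN.ρ.rTensor C s))) := by
        intro s
        induction s with
        | zero => simp
        | add x y hx hy => simp only [map_add, hx, hy]
        | tmul m c =>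
          simp only [LinearMap.lTensor_tmul, LinearMap.rTensor_tmul]
          have : ∀ r : N ⊗[K] C, ∀ u : (Y ⟶ X) ⊗[K] C, E.psiR g c = u →
              (TensorProduct.assoc K N (Y ⟶ X) (C ⊗[K] C)).symm
              (((TensorProduct.assoc K (Y ⟶ X) C C).toLinearMap ∘ₗ (E.ψ Y X).rTensor C ∘ₗ
              (TensorProduct.assoc K C (Y ⟶ X) C).symm.toLinearMap ∘ₗ
              (E.psiR g).lTensor C).lTensor N
                (TensorProduct.assoc K N C C (r ⊗ₜ c))) =
              (TensorProduct.assoc K N (Y ⟶ X) (C ⊗[K] C)).symm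
              (((TensorProduct.assoc K (Y ⟶ X) C C).toLinearMap ∘ₗ (E.ψ Y X).rTensor C ∘ₗ
              (TensorProduct.assoc K C (Y ⟶ X) C).symm.toLinearMap).lTensor N
                (TensorProduct.assoc K N C _ (r ⊗ₜ u))) := by
            rintro r u rfl
            induction r with
            | zero => simp
            | add x y hx hy => simp only [map_add, add_tmul, hx, hy]
            | tmul p d => simp
          rw [this _ _ rfl]
          induction E.psiR g c with
          | zero => simp
          | add x y hx hy => simp only [map_add, tmul_add, hx, hy]
          | tmul g' d =>
            rw [assoc_symm_tmul, LinearMap.rTensor_tmul, comodRho_tmul]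
            induction ρN.ρ m with
            | zero => simp
            | add x y hx hy => simp only [map_add, add_tmul, hx, hy]
            | tmul p e =>
              simp only [LinearMap.lTensor_tmul, assoc_tmul, LinearMap.comp_apply,
                LinearEquiv.coe_coe, assoc_symm_tmul, LinearMap.rTensor_tmul,
                EntwiningStructure.psiR_apply]
              induction E.ψ Y X (e ⊗ₜ g') with
              | zero => simp
              | add x y hx hy => simp only [map_add, add_tmul, tmul_add, hx, hy]
              | tmul a b => simp
      have key2 : ∀ s : N ⊗[K] C,
          (Coalgebra.comul (R := K) (A := C)).lTensor (N ⊗[K] (Y ⟶ X))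
            ((TensorProduct.assoc K N (Y ⟶ X) C).symm ((E.psiR g).lTensor N s)) =
          (TensorProduct.assoc K N (Y ⟶ X) (C ⊗[K] C)).symm
            (((TensorProduct.assoc K (Y ⟶ X) C C).toLinearMap ∘ₗ (E.ψ Y X).rTensor C ∘ₗ
              (TensorProduct.assoc K C (Y ⟶ X) C).symm.toLinearMap ∘ₗ
              (E.psiR g).lTensor C).lTensor N
                ((Coalgebra.comul (R := K) (A := C)).lTensor N s)) := by
        intro s
        induction s with
        | zero => simp
        | add x y hx hy => simp only [map_add, hx, hy]
        | tmul m c =>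
          have h3 := E.psi_comul g c
          simp only [LinearMap.lTensor_tmul, LinearMap.comp_apply, LinearEquiv.coe_coe]
          change _ = (TensorProduct.assoc K N (Y ⟶ X) (C ⊗[K] C)).symm (m ⊗ₜ
            (TensorProduct.assoc K (Y ⟶ X) C C ((E.ψ Y X).rTensor C
            ((TensorProduct.assoc K C (Y ⟶ X) C).symm
              ((E.ψ Y X ∘ₗ (TensorProduct.mk K C (Y ⟶ X)).flip g).lTensor C
              (Coalgebra.comul (R := K) c))))))
          rw [← h3, EntwiningStructure.psiR_apply]
          induction E.ψ Y X (c ⊗ₜ g) with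
          | zero => simp
          | add x y hx hy => simp only [map_add, tmul_add, hx, hy]
          | tmul a b => simp
      rw [comodRho_tmul, key, key2, ρN.coassoc]
  counit t := by
    induction t with
    | zero => simp
    | add x y hx hy => simp only [map_add, hx, hy]
    | tmul n g =>
      rw [comodRho_tmul]
      have key : ∀ s : N ⊗[K] C, TensorProduct.rid K (N ⊗[K] (Y ⟶ X))
          ((Coalgebra.counit (R := K) (A := C)).lTensor (N ⊗[K] (Y ⟶ X))
            ((TensorProduct.assoc K N (Y ⟶ X) C).symm ((E.psiR g).lTensor N s))) =
          TensorProduct.rid K N ((Coalgebra.counit (R := K) (A := C)).lTensor N s) ⊗ₜ g := by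
        intro s
        induction s with
        | zero => simp
        | add x y hx hy => simp only [map_add, add_tmul, hx, hy]
        | tmul m c =>
          have h2 := E.psi_counit g c
          simp only [LinearMap.lTensor_tmul, EntwiningStructure.psiR_apply, rid_tmul]
          rw [smul_tmul, ← h2]
          induction E.ψ Y X (c ⊗ₜ g) with
          | zero => simp
          | add x y hx hy => simp only [map_add, tmul_add, hx, hy]
          | tmul a b => simp
      rw [key, ρN.counit]

/-- The entwined module `N ⊗ h_X` of a right comodule `N` and an object `X`. -/
def comodTensor {N : Type u} [AddCommGroup N] [Module K N] (ρN : RightCoaction K C N) (X : D) :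
    EntwinedModule E where
  toMod := RightMod.ofAct (fun Y => N ⊗[K] (Y ⟶ X)) (comodAct N X)
    (fun Y t => by
      induction t with
      | zero => simp
      | add x y hx hy => simp only [map_add, hx, hy]
      | tmul a b => simp)
    (fun f g t => by
      induction t with
      | zero => simp
      | add x y hx hy => simp only [map_add, hx, hy]
      | tmul a b => simp)
  coact Y := comodCoaction E ρN X Y
  compat f t := comodRho_compat E ρN f t

/-- The map `C → C`, `x ↦ c*(x_2) x_1`. -/
def hit : Module.Dual K C →ₗ[K] C →ₗ[K] C where
  toFun d := (TensorProduct.rid K C).toLinearMap ∘ₗ d.lTensor C ∘ₗ Coalgebra.comul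
  map_add' d e := by ext x; simp [LinearMap.lTensor_add]
  map_smul' r d := by ext x; simp [LinearMap.lTensor_smul]

lemma hit_apply (d : Module.Dual K C) (x : C) :
    hit d x = TensorProduct.rid K C (d.lTensor C (Coalgebra.comul (R := K) x)) := rfl

lemma comul_hit (d : Module.Dual K C) (x : C) :
    Coalgebra.comul (R := K) (hit d x) = (hit d).lTensor C (Coalgebra.comul (R := K) x) := by
  have key : ∀ s : C ⊗[K] C, Coalgebra.comul (R := K)
      (TensorProduct.rid K C (d.lTensor C s)) =
      ((TensorProduct.rid K C).toLinearMap ∘ₗ d.lTensor C).lTensor C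
        (TensorProduct.assoc K C C C ((Coalgebra.comul (R := K) (A := C)).rTensor C s)) := by
    intro s
    induction s with
    | zero => simp
    | add x y hx hy => simp only [map_add, hx, hy]
    | tmul a b =>
      simp only [LinearMap.lTensor_tmul, rid_tmul, map_smul, LinearMap.rTensor_tmul]
      induction Coalgebra.comul (R := K) a with
      | zero => simp
      | add x y hx hy => simp only [map_add, add_tmul, smul_add, hx, hy]
      | tmul p q => simp
  rw [hit_apply, key, Coalgebra.coassoc_apply, ← LinearMap.comp_apply, ← LinearMap.lTensor_comp]
  rfl

lemma counit_hit (d : Module.Dual K C) (x : C) :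
    Coalgebra.counit (R := K) (hit d x) = d x := by
  have key : ∀ s : C ⊗[K] C, Coalgebra.counit (R := K)
      (TensorProduct.rid K C (d.lTensor C s)) =
      d (TensorProduct.lid K C ((Coalgebra.counit (R := K) (A := C)).rTensor C s)) := by
    intro s
    induction s with
    | zero => simp
    | add x y hx hy => simp only [map_add, hx, hy]
    | tmul a b => simp [mul_comm]
  rw [hit_apply, key, Coalgebra.rTensor_counit_comul]
  simp

/-- The left action `(f · φ)(x) = f_ψ ∘ φ(x^ψ)` of `f : Y ⟶ X` on `Hom_K(C, h_Y(Z))`. -/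
def leftHom {X Y Z : D} :
    (Y ⟶ X) →ₗ[K] (C →ₗ[K] (Z ⟶ Y)) →ₗ[K] (C →ₗ[K] (Z ⟶ X)) :=
  LinearMap.mk₂ K (fun f φ => compo Z Y X ∘ₗ φ.lTensor (Y ⟶ X) ∘ₗ E.psiR f)
    (fun f g φ => by ext x; simp [tmul_add])
    (fun r f φ => by ext x; simp)
    (fun f φ φ' => by ext x; simp [LinearMap.lTensor_add])
    (fun r f φ => by ext x; simp [LinearMap.lTensor_smul])

lemma leftHom_apply {X Y Z : D} (f : Y ⟶ X) (φ : C →ₗ[K] (Z ⟶ Y)) (x : C) :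
    leftHom E f φ x = compo Z Y X (φ.lTensor (Y ⟶ X) (E.ψ Y X (x ⊗ₜ f))) := rfl

lemma leftHom_id {X Z : D} (φ : C →ₗ[K] (Z ⟶ X)) : leftHom E (𝟙 X) φ = φ := by
  ext x
  rw [leftHom_apply, E.psi_id]
  simp

lemma leftHom_comp {W X Y Z : D} (f : Y ⟶ X) (g : X ⟶ W) (φ : C →ₗ[K] (Z ⟶ Y)) :
    leftHom E (f ≫ g) φ = leftHom E g (leftHom E f φ) := by
  ext x
  rw [leftHom_apply, leftHom_apply, E.psi_comp']
  induction E.ψ X W (x ⊗ₜ g) with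
  | zero => simp
  | add x y hx hy => simp only [map_add, hx, hy]
  | tmul k c =>
    rw [E.twist_tmul, LinearMap.lTensor_tmul, compo_tmul, leftHom_apply]
    induction E.ψ Y X (c ⊗ₜ f) with
    | zero => simp
    | add x y hx hy => simp only [map_add, hx, hy, Preadditive.add_comp]
    | tmul l d => simp

/-- The `C`-coaction on `Hom_K(C, h_Y(X))`: the map `x ↦ ψ(x_1 ⊗ φ(x_2))`. -/
def homRho {X Y : D} : (C →ₗ[K] (X ⟶ Y)) →ₗ[K] (C →ₗ[K] (X ⟶ Y) ⊗[K] C) where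
  toFun φ := E.ψ X Y ∘ₗ φ.lTensor C ∘ₗ Coalgebra.comul
  map_add' φ φ' := by ext x; simp [LinearMap.lTensor_add]
  map_smul' r φ := by ext x; simp [LinearMap.lTensor_smul]

lemma homRho_apply {X Y : D} (φ : C →ₗ[K] (X ⟶ Y)) (x : C) :
    homRho E φ x = E.ψ X Y (φ.lTensor C (Coalgebra.comul (R := K) x)) := rfl

/-- `b ⊗ c ↦ b ∘ Θ(c)`, for `Θ : C → Hom(X, Y) ⊗ C`. -/
def absorb {X Y Z : D} (Θ : C →ₗ[K] (X ⟶ Y) ⊗[K] C) :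
    (Y ⟶ Z) ⊗[K] C →ₗ[K] (X ⟶ Z) ⊗[K] C :=
  (compo X Y Z).rTensor C ∘ₗ (TensorProduct.assoc K (Y ⟶ Z) (X ⟶ Y) C).symm.toLinearMap ∘ₗ
    Θ.lTensor (Y ⟶ Z)

lemma absorb_tmul {X Y Z : D} (Θ : C →ₗ[K] (X ⟶ Y) ⊗[K] C) (b : Y ⟶ Z) (c : C) :
    absorb Θ (b ⊗ₜ c) = (Linear.rightComp K X b).rTensor C (Θ c) := by
  simp only [absorb, LinearMap.comp_apply, LinearMap.lTensor_tmul, LinearEquiv.coe_coe]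
  induction Θ c with
  | zero => simp
  | add x y hx hy => simp only [map_add, tmul_add, hx, hy]
  | tmul l d => simp

lemma absorb_add {X Y Z : D} (Θ Θ' : C →ₗ[K] (X ⟶ Y) ⊗[K] C) (u : (Y ⟶ Z) ⊗[K] C) :
    absorb (Θ + Θ') u = absorb Θ u + absorb Θ' u := by
  simp [absorb, LinearMap.lTensor_add]

lemma absorb_rightComp {W X Y Z : D} (Θ : C →ₗ[K] (X ⟶ Y) ⊗[K] C) (b : Z ⟶ W)
    (u : (Y ⟶ Z) ⊗[K] C) :
    absorb Θ ((Linear.rightComp K Y b).rTensor C u) =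
      (Linear.rightComp K X b).rTensor C (absorb Θ u) := by
  induction u with
  | zero => simp
  | add x y hx hy => simp only [map_add, hx, hy]
  | tmul a c =>
    rw [LinearMap.rTensor_tmul, absorb_tmul, absorb_tmul]
    induction Θ c with
    | zero => simp
    | add x y hx hy => simp only [map_add, hx, hy]
    | tmul k d => simp

lemma homRho_leftHom {X Y Z : D} (f : Y ⟶ X) (φ : C →ₗ[K] (Z ⟶ Y)) (x : C) :
    homRho E (leftHom E f φ) x = absorb (homRho E φ) (E.ψ Y X (x ⊗ₜ f)) := by
  have key : ∀ u : (Y ⟶ X) ⊗[K] C, absorb (homRho E φ) u =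
      (compo Z Y X).rTensor C ((TensorProduct.assoc K (Y ⟶ X) (Z ⟶ Y) C).symm
        ((E.ψ Z Y ∘ₗ φ.lTensor C).lTensor (Y ⟶ X)
          ((Coalgebra.comul (R := K) (A := C)).lTensor (Y ⟶ X) u))) := by
    intro u
    rw [← LinearMap.comp_apply (LinearMap.lTensor _ _), ← LinearMap.lTensor_comp]
    rfl
  have key2 : ∀ s : C ⊗[K] C, E.ψ Z X ((leftHom E f φ).lTensor C s) =
      (compo Z Y X).rTensor C ((TensorProduct.assoc K (Y ⟶ X) (Z ⟶ Y) C).symm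
        ((E.ψ Z Y ∘ₗ φ.lTensor C).lTensor (Y ⟶ X)
          (TensorProduct.assoc K (Y ⟶ X) C C ((E.ψ Y X).rTensor C
            ((TensorProduct.assoc K C (Y ⟶ X) C).symm ((E.psiR f).lTensor C s)))))) := by
    intro s
    induction s with
    | zero => simp
    | add x y hx hy => simp only [map_add, hx, hy]
    | tmul c₁ c₂ =>
      rw [LinearMap.lTensor_tmul, LinearMap.lTensor_tmul]
      change E.ψ Z X (c₁ ⊗ₜ compo Z Y X (φ.lTensor (Y ⟶ X) (E.psiR f c₂))) = _
      induction E.psiR f c₂ with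
      | zero => simp
      | add x y hx hy => simp only [map_add, tmul_add, hx, hy]
      | tmul g d =>
        simp only [LinearMap.lTensor_tmul, compo_tmul, assoc_symm_tmul, LinearMap.rTensor_tmul]
        rw [E.psi_comp']
        induction E.ψ Y X (c₁ ⊗ₜ g) with
        | zero => simp
        | add x y hx hy => simp only [map_add, add_tmul, hx, hy]
        | tmul k e =>
          rw [E.twist_tmul]
          simp only [assoc_tmul, LinearMap.lTensor_tmul, LinearMap.comp_apply]
          induction E.ψ Z Y (e ⊗ₜ φ d) with
          | zero => simp
          | add x y hx hy => simp only [map_add, tmul_add, hx, hy]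
          | tmul l m => simp
  rw [key, E.psi_comul, homRho_apply, key2]
  rfl

lemma leftHom_leftComp {W X Y Z : D} (f : Y ⟶ X) (g : W ⟶ Z) (φ : C →ₗ[K] (Z ⟶ Y)) :
    leftHom E f (Linear.leftComp K Y g ∘ₗ φ) = Linear.leftComp K X g ∘ₗ leftHom E f φ := by
  ext x
  rw [LinearMap.comp_apply, leftHom_apply, leftHom_apply]
  induction E.ψ Y X (x ⊗ₜ f) with
  | zero => simp
  | add x y hx hy => simp only [map_add, hx, hy]
  | tmul k c => simp

lemma absorb_flip_mk {X Y Z : D} (φ : C →ₗ[K] (X ⟶ Y)) (c : C) (u : (Y ⟶ Z) ⊗[K] C) :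
    absorb ((TensorProduct.mk K (X ⟶ Y) C).flip c ∘ₗ φ) u =
      compo X Y Z (φ.lTensor (Y ⟶ Z) u) ⊗ₜ c := by
  induction u with
  | zero => simp
  | add x y hx hy => simp only [map_add, add_tmul, hx, hy]
  | tmul b d => rw [absorb_tmul]; simp

section FiniteDimensional

variable [FiniteDimensional K C]

/-- For `C` finite dimensional, the isomorphism `C* ⊗ V ≅ Hom_K(C, V)`,
`c* ⊗ v ↦ (x ↦ c*(x) v)`. -/
def dualIso (K : Type u) [Field K] (C : Type u) [AddCommGroup C] [Module K C]
    [FiniteDimensional K C] (V : Type u) [AddCommGroup V] [Module K V] :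
    Module.Dual K C ⊗[K] V ≃ₗ[K] (C →ₗ[K] V) := dualTensorHomEquiv K C V

@[simp] lemma dualIso_tmul (V : Type u) [AddCommGroup V] [Module K V] (d : Module.Dual K C)
    (v : V) (x : C) : dualIso K C V (d ⊗ₜ v) x = d x • v := rfl

/-- With a basis `d_i` of `C` and dual basis `d_i*`, the inverse of the isomorphism
`C* ⊗ V ≅ Hom_K(C, V)` is `φ ↦ ∑ d_i* ⊗ φ(d_i)`. -/
lemma dualIso_symm_eq {ι : Type*} [Fintype ι] (b : Module.Basis ι K C) (V : Type u)
    [AddCommGroup V] [Module K V] (φ : C →ₗ[K] V) :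
    (dualIso K C V).symm φ = ∑ i, b.coord i ⊗ₜ φ (b i) := by
  rw [LinearEquiv.symm_apply_eq]
  ext x
  simp only [map_sum, LinearMap.sum_apply, dualIso_tmul, Module.Basis.coord_apply,
    ← map_smul]
  rw [← map_sum, b.sum_repr]

lemma dualIso_lTensor {V W : Type u} [AddCommGroup V] [Module K V] [AddCommGroup W] [Module K W]
    (α : V →ₗ[K] W) (t : Module.Dual K C ⊗[K] V) :
    dualIso K C W (α.lTensor _ t) = α ∘ₗ dualIso K C V t := by
  induction t with
  | zero => ext; simp
  | add x y hx hy => simp only [map_add, hx, hy, LinearMap.comp_add]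
  | tmul d v => ext; simp

lemma dualIso_assoc_tmul {V : Type u} [AddCommGroup V] [Module K V]
    (t : Module.Dual K C ⊗[K] V) (c : C) :
    dualIso K C (V ⊗[K] C) (TensorProduct.assoc K _ V C (t ⊗ₜ c)) =
      (TensorProduct.mk K V C).flip c ∘ₗ dualIso K C V t := by
  induction t with
  | zero => ext; simp
  | add x y hx hy => simp only [map_add, add_tmul, hx, hy, LinearMap.comp_add]
  | tmul e v => ext; simp [smul_tmul']

/-- The right `C`-comodule structure on `C*` coming from the left multiplication of the
convolution algebra `C*` on itself: under `C* ⊗ C ≅ Hom_K(C, C)`, the element `ρ(c*)` is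
`x ↦ c*(x_2) x_1`, that is, `ρ(c*) = ∑ d_i* • c* ⊗ d_i`. -/
def dualCoaction (K : Type u) [Field K] (C : Type u) [AddCommGroup C] [Module K C]
    [Coalgebra K C] [FiniteDimensional K C] : RightCoaction K C (Module.Dual K C) where
  ρ := (dualIso K C C).symm.toLinearMap ∘ₗ hit
  coassoc d := by
    apply (dualIso K C (C ⊗[K] C)).injective
    have key : ∀ t : Module.Dual K C ⊗[K] C, dualIso K C (C ⊗[K] C)
        (TensorProduct.assoc K _ C C
          (((dualIso K C C).symm.toLinearMap ∘ₗ hit).rTensor C t)) =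
        (dualIso K C C t).lTensor C ∘ₗ Coalgebra.comul := by
      intro t
      induction t with
      | zero => ext; simp
      | add x y hx hy => simp only [map_add, hx, hy, LinearMap.lTensor_add, LinearMap.add_comp]
      | tmul e y =>
        rw [LinearMap.rTensor_tmul, dualIso_assoc_tmul]
        ext x
        simp only [LinearMap.comp_apply, LinearEquiv.coe_coe, LinearEquiv.apply_symm_apply,
          hit_apply]
        induction Coalgebra.comul (R := K) x with
        | zero => simp
        | add x y hx hy => simp only [map_add, hx, hy]
        | tmul a b => simp
    rw [key, dualIso_lTensor]
    ext x
    simp [comul_hit]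
  counit d := by
    have key : ∀ (t : Module.Dual K C ⊗[K] K), TensorProduct.rid K _ t = dualIso K C K t := by
      intro t
      induction t with
      | zero => ext; simp
      | add x y hx hy => simp only [map_add, hx, hy]
      | tmul e y => ext x; simp [mul_comm]
    rw [key, dualIso_lTensor]
    ext x
    simp [counit_hit]

lemma dualIso_rho (d : Module.Dual K C) : dualIso K C C ((dualCoaction K C).ρ d) = hit d := by
  simp [dualCoaction]

/-- The formula `ρ(c*) = ∑ d_i* • c* ⊗ d_i`, where `•` is the convolution product of `C*`. -/
lemma dualCoaction_eq {ι : Type*} [Fintype ι] (b : Module.Basis ι K C) (d : Module.Dual K C) :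
    (dualCoaction K C).ρ d =
      ∑ i, (WithConv.toConv (b.coord i) * WithConv.toConv d).ofConv ⊗ₜ b i := by
  apply (dualIso K C C).injective
  rw [dualIso_rho]
  ext x
  have key : ∀ i, (WithConv.toConv (b.coord i) * WithConv.toConv d).ofConv x =
      b.coord i (hit d x) := by
    intro i
    change LinearMap.mul' K K (TensorProduct.map (b.coord i) d (Coalgebra.comul (R := K) x)) = _
    rw [hit_apply]
    induction Coalgebra.comul (R := K) x with
    | zero => simp
    | add x y hx hy => simp only [map_add, hx, hy]
    | tmul a b => simp [mul_comm]
  simp only [map_sum, LinearMap.sum_apply, dualIso_tmul, key, Module.Basis.coord_apply]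
  rw [b.sum_repr]

lemma homRho_dualIso_tmul {X Y : D} (d : Module.Dual K C) (g : X ⟶ Y) (x : C) :
    homRho E (dualIso K C (X ⟶ Y) (d ⊗ₜ g)) x = E.ψ X Y (hit d x ⊗ₜ g) := by
  rw [homRho_apply, hit_apply]
  congr 1
  induction Coalgebra.comul (R := K) x with
  | zero => simp
  | add x y hx hy => simp only [map_add, add_tmul, hx, hy]
  | tmul a b => simp [smul_tmul]

/-- Under `C* ⊗ V ≅ Hom_K(C, V)` the coaction of `C* ⊗ h_Y(X)` is `φ ↦ (x ↦ ψ(x_1 ⊗ φ(x_2)))`. -/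
lemma dualIso_comodRho {X Y : D} (t : Module.Dual K C ⊗[K] (X ⟶ Y)) :
    dualIso K C ((X ⟶ Y) ⊗[K] C)
      (TensorProduct.assoc K _ _ C (comodRho E (dualCoaction K C) Y X t)) =
      homRho E (dualIso K C (X ⟶ Y) t) := by
  induction t with
  | zero => simp
  | add x y hx hy => simp only [map_add, hx, hy]
  | tmul d g =>
    rw [comodRho_tmul, LinearEquiv.apply_symm_apply, dualIso_lTensor, dualIso_rho]
    ext x
    rw [homRho_dualIso_tmul, LinearMap.comp_apply, E.psiR_apply]

/-- The map `C* ⊗ h_Y(Z) → C* ⊗ h_X(Z)` given by `f : Y ⟶ X`; it is transported from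
`Hom_K(C, h_Y(Z)) → Hom_K(C, h_X(Z))`, so that `c* ⊗ g ↦ ∑ c*(d_i^ψ) d_i* ⊗ f_ψ g`. -/
def dualLeft {X Y : D} (f : Y ⟶ X) (Z : D) :
    Module.Dual K C ⊗[K] (Z ⟶ Y) →ₗ[K] Module.Dual K C ⊗[K] (Z ⟶ X) :=
  (dualIso K C (Z ⟶ X)).symm.toLinearMap ∘ₗ leftHom E f ∘ₗ (dualIso K C (Z ⟶ Y)).toLinearMap

lemma dualIso_dualLeft {X Y Z : D} (f : Y ⟶ X) (t : Module.Dual K C ⊗[K] (Z ⟶ Y)) :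
    dualIso K C (Z ⟶ X) (dualLeft E f Z t) = leftHom E f (dualIso K C (Z ⟶ Y) t) := by
  simp [dualLeft]

/-- The formula `c* ⊗ g ↦ ∑ d_i* ⊗ c*(d_i^ψ) f_ψ g`. -/
lemma dualLeft_tmul_eq {ι : Type*} [Fintype ι] (b : Module.Basis ι K C) {X Y Z : D} (f : Y ⟶ X)
    (d : Module.Dual K C) (g : Z ⟶ Y) :
    dualLeft E f Z (d ⊗ₜ g) = ∑ i, b.coord i ⊗ₜ (g ≫ TensorProduct.rid K (Y ⟶ X)
      (d.lTensor (Y ⟶ X) (E.ψ Y X (b i ⊗ₜ f)))) := by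
  refine (dualIso_symm_eq b (Z ⟶ X) _).trans (Finset.sum_congr rfl fun i _ => ?_)
  congr 1
  rw [LinearMap.comp_apply, LinearEquiv.coe_coe, leftHom_apply]
  induction E.ψ Y X (b i ⊗ₜ f) with
  | zero => simp
  | add x y hx hy => simp only [map_add, hx, hy, Preadditive.comp_add]
  | tmul k c => simp

lemma dualLeft_comodAct {W X Y Z : D} (f : Y ⟶ X) (g : W ⟶ Z)
    (t : Module.Dual K C ⊗[K] (Z ⟶ Y)) :
    dualLeft E f W (comodAct _ Y g t) = comodAct _ X g (dualLeft E f Z t) := by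
  apply (dualIso K C (W ⟶ X)).injective
  rw [dualIso_dualLeft]
  refine (congrArg (leftHom E f) (dualIso_lTensor (Linear.leftComp K Y g) t)).trans ?_
  refine Eq.trans ?_ (dualIso_lTensor (Linear.leftComp K X g) _).symm
  rw [dualIso_dualLeft, leftHom_leftComp]

lemma dualIso_dualLeft_rTensor {X Y Z : D} (f : Y ⟶ X)
    (s : (Module.Dual K C ⊗[K] (Z ⟶ Y)) ⊗[K] C) (x : C) :
    dualIso K C _ (TensorProduct.assoc K _ _ C ((dualLeft E f Z).rTensor C s)) x =
      absorb (dualIso K C _ (TensorProduct.assoc K _ _ C s)) (E.ψ Y X (x ⊗ₜ f)) := by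
  induction s with
  | zero => simp [absorb]
  | add s t hs ht =>
    simp only [map_add, LinearMap.add_apply, hs, ht]
    simp [absorb, LinearMap.lTensor_add]
  | tmul t c =>
    rw [LinearMap.rTensor_tmul, dualIso_assoc_tmul, dualIso_assoc_tmul, dualIso_dualLeft,
      absorb_flip_mk]
    rfl

lemma dualLeft_colinear {X Y Z : D} (f : Y ⟶ X) (t : Module.Dual K C ⊗[K] (Z ⟶ Y)) :
    comodRho E (dualCoaction K C) X Z (dualLeft E f Z t) =
      (dualLeft E f Z).rTensor C (comodRho E (dualCoaction K C) Y Z t) := by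
  apply (TensorProduct.assoc K _ _ C).injective
  apply (dualIso K C _).injective
  ext x
  rw [dualIso_dualLeft_rTensor, dualIso_comodRho, dualIso_comodRho, dualIso_dualLeft,
    homRho_leftHom]

lemma dualLeft_id {Y Z : D} (t : Module.Dual K C ⊗[K] (Z ⟶ Y)) :
    dualLeft E (𝟙 Y) Z t = t := by
  apply (dualIso K C (Z ⟶ Y)).injective
  rw [dualIso_dualLeft, leftHom_id]

lemma dualLeft_comp {W X Y Z : D} (f : Y ⟶ X) (g : X ⟶ W)
    (t : Module.Dual K C ⊗[K] (Z ⟶ Y)) :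
    dualLeft E (f ≫ g) Z t = dualLeft E g Z (dualLeft E f Z t) := by
  apply (dualIso K C (Z ⟶ W)).injective
  rw [dualIso_dualLeft, dualIso_dualLeft, dualIso_dualLeft, leftHom_comp]

/-- The functor `C* ⊗ h : D ⥤ M(ψ)`, `Y ↦ C* ⊗ h_Y`, sending `f : Y ⟶ X` to the morphism
`c* ⊗ g ↦ ∑ c*(d_i^ψ) d_i* ⊗ f_ψ g`. -/
def dualTensorH : D ⥤ EntwinedModule E where
  obj Y := comodTensor E (dualCoaction K C) Y
  map {Y X} f :=
    { hom := RightMod.homOf (M := (comodTensor E (dualCoaction K C) Y).toMod)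
        (N := (comodTensor E (dualCoaction K C) X).toMod) (fun Z => dualLeft E f Z)
        (fun g t => dualLeft_comodAct E f g t)
      colinear Z t := dualLeft_colinear E f t }
  map_id Y := by
    ext Z t
    exact dualLeft_id E t
  map_comp f g := by
    ext Z t
    exact dualLeft_comp E f g t

end FiniteDimensional

/-! ### The spaces `V₁` and `W₁` -/

/-- The space `V₁` of families `θ_X : C ⊗ C → End_D(X)` such that
`θ_X(c ⊗ d) ∘ f = (f_ψ)_ψ ∘ θ_Y(c^ψ ⊗ d^ψ)` for `f : Y ⟶ X`, and
`θ_X(c ⊗ d_1) ⊗ d_2 = (θ_X(c_2 ⊗ d))_ψ ⊗ (c_1)^ψ`. -/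
structure V1 where
  θ : ∀ X : D, C ⊗[K] C →ₗ[K] (X ⟶ X)
  theta_comp : ∀ {X Y : D} (f : Y ⟶ X) (c d : C),
    f ≫ θ X (c ⊗ₜ d) = compo Y Y X ((θ Y).lTensor (Y ⟶ X)
      (TensorProduct.assoc K (Y ⟶ X) C C
        ((E.ψ Y X ∘ₗ TensorProduct.mk K C (Y ⟶ X) c).rTensor C (E.ψ Y X (d ⊗ₜ f)))))
  theta_comul : ∀ (X : D) (c d : C),
    (θ X).rTensor C ((TensorProduct.assoc K C C C).symm
      (c ⊗ₜ Coalgebra.comul (R := K) d)) =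
    E.ψ X X ((θ X).lTensor C (TensorProduct.assoc K C C C
      (Coalgebra.comul (R := K) c ⊗ₜ d)))

/-- The space `W₁ = Nat(h, h ⊗ C)`, where `h ⊗ C` is regarded as a functor `D ⥤ Mod-D`
(equivalently, as a `D`-`D`-bimodule). -/
abbrev W1 : Type _ := h K D ⟶ hTensorC E ⋙ forgetCoaction E

variable {E} in
/-- The element `∑ a_Y ⊗ c_Y = η(Y, Y)(id_Y)`. -/
def W1.unit (η : W1 E) (Y : D) : (Y ⟶ Y) ⊗[K] C := RightMod.app (η.app Y) Y (𝟙 Y)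

lemma W1.twist_unit (η : W1 E) {Y Z : D} (g : Y ⟶ Z) :
    E.twist (Linear.comp Y Z Z) g (η.unit Z) = (Linear.rightComp K Y g).rTensor C (η.unit Y) := by
  have h1 := RightMod.app_act (η.app Z) g (𝟙 Z)
  have h2 : RightMod.app ((h K D).map g ≫ η.app Z) Y (𝟙 Y) =
      RightMod.app (η.app Y ≫ (hTensorC E ⋙ forgetCoaction E).map g) Y (𝟙 Y) := by
    rw [η.naturality]
  have h3 : RightMod.app ((h K D).map g) Y (𝟙 Y) = ((h K D).obj Z).act g (𝟙 Z) :=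
    (Category.id_comp g).trans (Category.comp_id g).symm
  refine Eq.trans h1.symm (Eq.trans ?_ h2)
  rw [← h3]
  rfl

section FiniteDimensional

variable [FiniteDimensional K C]

variable {E}

/-! ### The maps `α' : V₁ → Nat(h ⊗ C, C* ⊗ h)` and `γ' : W₁ → Nat(C* ⊗ h, h ⊗ C)` -/

/-- The map `f ⊗ c ↦ (d ↦ f_ψ ∘ θ_X(d^ψ ⊗ c))`. -/
def V1.upsilonHom (θ : V1 E) (X Y : D) : (X ⟶ Y) ⊗[K] C →ₗ[K] (C →ₗ[K] (X ⟶ Y)) :=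
  TensorProduct.lift ((leftHom E).compl₂ (TensorProduct.curry (θ.θ X)).flip)

/-- `Υ_{XY} : h_Y(X) ⊗ C → C* ⊗ h_Y(X)`,
`f ⊗ c ↦ ∑ d_i* ⊗ f_ψ ∘ θ_X(d_i^ψ ⊗ c)`. -/
def V1.upsilon (θ : V1 E) (X Y : D) :
    (X ⟶ Y) ⊗[K] C →ₗ[K] Module.Dual K C ⊗[K] (X ⟶ Y) :=
  (dualIso K C (X ⟶ Y)).symm.toLinearMap ∘ₗ θ.upsilonHom X Y

lemma V1.dualIso_upsilon (θ : V1 E) {X Y : D} (t : (X ⟶ Y) ⊗[K] C) :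
    dualIso K C (X ⟶ Y) (θ.upsilon X Y t) = θ.upsilonHom X Y t := by
  simp [V1.upsilon]

lemma V1.upsilonHom_tmul (θ : V1 E) {X Y : D} (f : X ⟶ Y) (c : C) :
    θ.upsilonHom X Y (f ⊗ₜ c) = leftHom E f ((TensorProduct.curry (θ.θ X)).flip c) := rfl

/-- The formula `Υ_{XY}(f ⊗ c) = ∑ d_i* ⊗ f_ψ ∘ θ_X(d_i^ψ ⊗ c)`. -/
lemma V1.upsilon_eq {ι : Type*} [Fintype ι] (b : Module.Basis ι K C) (θ : V1 E) {X Y : D}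
    (f : X ⟶ Y) (c : C) :
    θ.upsilon X Y (f ⊗ₜ c) = ∑ i, b.coord i ⊗ₜ compo X X Y
      ((θ.θ X ∘ₗ (TensorProduct.mk K C C).flip c).lTensor (X ⟶ Y) (E.ψ X Y (b i ⊗ₜ f))) :=
  dualIso_symm_eq b (X ⟶ Y) _

lemma V1.upsilonHom_rightComp (θ : V1 E) {X Y Z : D} (f : Y ⟶ Z) (u : (X ⟶ Y) ⊗[K] C) :
    θ.upsilonHom X Z ((Linear.rightComp K X f).rTensor C u) =
      leftHom E f (θ.upsilonHom X Y u) := by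
  induction u with
  | zero => simp
  | add x y hx hy => simp only [map_add, hx, hy]
  | tmul k c =>
    rw [LinearMap.rTensor_tmul, upsilonHom_tmul, upsilonHom_tmul, ← leftHom_comp]
    rfl

lemma V1.leftComp_theta (θ : V1 E) {X Y : D} (g : Y ⟶ X) (c : C) :
    Linear.leftComp K X g ∘ₗ (TensorProduct.curry (θ.θ X)).flip c =
      θ.upsilonHom Y X (E.ψ Y X (c ⊗ₜ g)) := by
  ext y
  refine (θ.theta_comp g y c).trans ?_
  induction E.ψ Y X (c ⊗ₜ g) with
  | zero => simp
  | add x y hx hy => simp only [map_add, hx, hy, LinearMap.add_apply]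
  | tmul k e =>
    rw [upsilonHom_tmul, leftHom_apply, LinearMap.rTensor_tmul, LinearMap.comp_apply,
      TensorProduct.mk_apply]
    induction E.ψ Y X (y ⊗ₜ k) with
    | zero => simp
    | add x y hx hy => simp only [map_add, add_tmul, hx, hy]
    | tmul l m => simp

lemma V1.upsilon_act (θ : V1 E) {X Y Z : D} (g : Z ⟶ X) (t : (X ⟶ Y) ⊗[K] C) :
    θ.upsilon Z Y (E.twist (Linear.comp Z X Y) g t) = comodAct _ Y g (θ.upsilon X Y t) := by
  apply (dualIso K C (Z ⟶ Y)).injective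
  refine Eq.trans ?_ (dualIso_lTensor (Linear.leftComp K Y g) _).symm
  rw [dualIso_upsilon, dualIso_upsilon]
  induction t with
  | zero => simp
  | add x y hx hy => simp only [map_add, hx, hy, LinearMap.comp_add]
  | tmul f c =>
    rw [E.twist_tmul, upsilonHom_tmul, ← leftHom_leftComp, leftComp_theta,
      ← upsilonHom_rightComp]
    rfl

lemma V1.upsilon_colinear (θ : V1 E) {X Y : D} (t : (X ⟶ Y) ⊗[K] C) :
    comodRho E (dualCoaction K C) Y X (θ.upsilon X Y t) =
      (θ.upsilon X Y).rTensor C ((freeCoaction K C (X ⟶ Y)).ρ t) := by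
  apply (TensorProduct.assoc K _ _ C).injective
  apply (dualIso K C _).injective
  rw [dualIso_comodRho, dualIso_upsilon]
  induction t with
  | zero => simp
  | add x y hx hy => simp only [map_add, hx, hy]
  | tmul f c =>
    have key : ∀ (s : C ⊗[K] C) (x : C), dualIso K C _ (TensorProduct.assoc K _ _ C
        ((θ.upsilon X Y).rTensor C ((TensorProduct.assoc K _ _ _).symm (f ⊗ₜ s)))) x =
        absorb (((θ.θ X).rTensor C ∘ₗ (TensorProduct.assoc K C C C).symm.toLinearMap) ∘ₗ
          (TensorProduct.mk K C (C ⊗[K] C)).flip s) (E.ψ X Y (x ⊗ₜ f)) := by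
      intro s x
      induction s with
      | zero => simp [absorb]
      | add s t hs ht =>
        simp only [map_add, tmul_add, LinearMap.add_apply, hs, ht, LinearMap.comp_add,
          absorb_add]
      | tmul a b =>
        rw [assoc_symm_tmul, LinearMap.rTensor_tmul, dualIso_assoc_tmul, dualIso_upsilon,
          upsilonHom_tmul]
        have : ((θ.θ X).rTensor C ∘ₗ (TensorProduct.assoc K C C C).symm.toLinearMap) ∘ₗ
            (TensorProduct.mk K C (C ⊗[K] C)).flip (a ⊗ₜ b) =
            (TensorProduct.mk K (X ⟶ X) C).flip b ∘ₗ
              (TensorProduct.curry (θ.θ X)).flip a := by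
          ext y
          simp
        rw [this, absorb_flip_mk]
        rfl
    ext x
    refine Eq.trans ?_ (key (Coalgebra.comul (R := K) c) x).symm
    rw [upsilonHom_tmul, homRho_leftHom]
    congr 2
    ext y
    refine Eq.trans ?_ (θ.theta_comul X y c).symm
    rw [homRho_apply]
    congr 1
    induction Coalgebra.comul (R := K) y with
    | zero => simp
    | add x y hx hy => simp only [map_add, add_tmul, hx, hy]
    | tmul l m => simp

lemma V1.upsilon_natural (θ : V1 E) {X Y Z : D} (f : Y ⟶ Z) (t : (X ⟶ Y) ⊗[K] C) :
    θ.upsilon X Z ((Linear.rightComp K X f).rTensor C t) =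
      dualLeft E f X (θ.upsilon X Y t) := by
  apply (dualIso K C _).injective
  rw [dualIso_upsilon, dualIso_dualLeft, dualIso_upsilon, upsilonHom_rightComp]

/-- The map `α'`, sending `θ ∈ V₁` to the natural transformation `Υ : h ⊗ C ⟶ C* ⊗ h`,
`Υ_{XY}(f ⊗ c) = ∑ d_i* ⊗ f_ψ ∘ θ_X(d_i^ψ ⊗ c)`. -/
def alphaPrime (θ : V1 E) : hTensorC E ⟶ dualTensorH E where
  app Y :=
    { hom := RightMod.homOf (M := ((hTensorC E).obj Y).toMod)
        (N := ((dualTensorH E).obj Y).toMod) (fun X => θ.upsilon X Y)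
        (fun g t => θ.upsilon_act g t)
      colinear X t := θ.upsilon_colinear t }
  naturality Y Z f := by
    ext X t
    exact θ.upsilon_natural f t

/-- `Φ_{XY} : C* ⊗ h_Y(X) → h_Y(X) ⊗ C`,
`c* ⊗ f ↦ ∑ a_Y f_ψ ⊗ c*((c_Y)_2) ((c_Y)_1)^ψ`. -/
def W1.phi (η : W1 E) (X Y : D) :
    Module.Dual K C ⊗[K] (X ⟶ Y) →ₗ[K] (X ⟶ Y) ⊗[K] C :=
  TensorProduct.lift (LinearMap.mk₂ K
    (fun d f => E.twist (Linear.comp X Y Y) f ((hit d).lTensor (Y ⟶ Y) (η.unit Y)))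
    (fun d d' f => by simp [LinearMap.lTensor_add])
    (fun r d f => by simp [LinearMap.lTensor_smul])
    (fun d f g => by simp)
    (fun r d f => by simp))

lemma W1.phi_tmul (η : W1 E) {X Y : D} (d : Module.Dual K C) (f : X ⟶ Y) :
    η.phi X Y (d ⊗ₜ f) =
      E.twist (Linear.comp X Y Y) f ((hit d).lTensor (Y ⟶ Y) (η.unit Y)) := rfl

lemma W1.phi_eq_absorb (η : W1 E) {X Y : D} (t : Module.Dual K C ⊗[K] (X ⟶ Y)) :
    η.phi X Y t = absorb (homRho E (dualIso K C (X ⟶ Y) t)) (η.unit Y) := by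
  induction t with
  | zero => simp [absorb]
  | add x y hx hy => simp only [map_add, hx, hy, absorb_add]
  | tmul d f =>
    rw [phi_tmul]
    induction η.unit Y with
    | zero => simp
    | add x y hx hy => simp only [map_add, hx, hy]
    | tmul b c =>
      rw [absorb_tmul, homRho_dualIso_tmul, LinearMap.lTensor_tmul, E.twist_tmul]
      rfl

lemma W1.phi_act (η : W1 E) {X Y Z : D} (g : Z ⟶ X) (t : Module.Dual K C ⊗[K] (X ⟶ Y)) :
    η.phi Z Y (comodAct _ Y g t) = E.twist (Linear.comp Z X Y) g (η.phi X Y t) := by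
  induction t with
  | zero => simp
  | add x y hx hy => simp only [map_add, hx, hy]
  | tmul d f =>
    rw [comodAct_tmul, phi_tmul, phi_tmul]
    exact E.twist_comp _ _ _ (fun f g v => Category.assoc f g v) g f _

lemma W1.phi_colinear_id (η : W1 E) (Y : D) (d : Module.Dual K C) :
    (freeCoaction K C (Y ⟶ Y)).ρ ((hit d).lTensor (Y ⟶ Y) (η.unit Y)) =
      (η.phi Y Y).rTensor C (comodRho E (dualCoaction K C) Y Y (d ⊗ₜ 𝟙 Y)) := by
  have key : ∀ s : Module.Dual K C ⊗[K] C, (η.phi Y Y).rTensor C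
      ((TensorProduct.assoc K _ _ C).symm ((E.psiR (𝟙 Y)).lTensor _ s)) =
      (TensorProduct.assoc K _ C C).symm
        (((dualIso K C C s).lTensor C ∘ₗ Coalgebra.comul).lTensor (Y ⟶ Y) (η.unit Y)) := by
    intro s
    induction s with
    | zero => simp
    | add x y hx hy =>
      simp only [map_add, hx, hy, LinearMap.lTensor_add, LinearMap.add_comp, LinearMap.add_apply]
    | tmul e y =>
      rw [LinearMap.lTensor_tmul, E.psiR_apply, E.psi_id, assoc_symm_tmul,
        LinearMap.rTensor_tmul, phi_tmul, E.twist_id _ (fun v => Category.id_comp v)]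
      induction η.unit Y with
      | zero => simp
      | add x y hx hy => simp only [map_add, add_tmul, hx, hy]
      | tmul a x =>
        rw [LinearMap.lTensor_tmul, LinearMap.lTensor_tmul, LinearMap.comp_apply, hit_apply]
        induction Coalgebra.comul (R := K) x with
        | zero => simp
        | add x y hx hy => simp only [map_add, add_tmul, tmul_add, hx, hy]
        | tmul p q => simp [smul_tmul]
  rw [comodRho_tmul, key, dualIso_rho]
  change (TensorProduct.assoc K _ C C).symm ((Coalgebra.comul (R := K) (A := C)).lTensor _
    ((hit d).lTensor (Y ⟶ Y) (η.unit Y))) = _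
  rw [← LinearMap.comp_apply (LinearMap.lTensor _ _), ← LinearMap.lTensor_comp]
  congr 3
  ext x
  exact comul_hit d x

lemma W1.phi_colinear (η : W1 E) {X Y : D} (t : Module.Dual K C ⊗[K] (X ⟶ Y)) :
    (freeCoaction K C (X ⟶ Y)).ρ (η.phi X Y t) =
      (η.phi X Y).rTensor C (comodRho E (dualCoaction K C) Y X t) := by
  induction t with
  | zero => simp
  | add x y hx hy => simp only [map_add, hx, hy]
  | tmul d f =>
    have hf : d ⊗ₜ[K] f = comodAct _ Y f (d ⊗ₜ[K] 𝟙 Y) := by simp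
    rw [hf, comodRho_compat,
      E.twist_natural (comodAct _ Y) (E.twist (Linear.comp X Y Y)) (η.phi Y Y) (η.phi X Y)
        (fun g v => phi_act η g v), ← phi_colinear_id, phi_act, phi_tmul,
      E.twist_id _ (fun v => Category.id_comp v)]
    exact freeCoaction_compat E _ f _

lemma W1.phi_natural (η : W1 E) {X Y Z : D} (g : Y ⟶ Z) (t : Module.Dual K C ⊗[K] (X ⟶ Y)) :
    η.phi X Z (dualLeft E g X t) = (Linear.rightComp K X g).rTensor C (η.phi X Y t) := by
  rw [phi_eq_absorb, phi_eq_absorb, ← absorb_rightComp, ← twist_unit, dualIso_dualLeft]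
  induction η.unit Z with
  | zero => simp
  | add x y hx hy => simp only [map_add, hx, hy]
  | tmul b c =>
    rw [absorb_tmul, homRho_leftHom, ← absorb_rightComp, E.twist_tmul]
    rfl

/-- The map `γ'`, sending `η ∈ W₁` to the natural transformation `Φ : C* ⊗ h ⟶ h ⊗ C`,
`Φ_{XY}(c* ⊗ f) = ∑ a_Y f_ψ ⊗ c*((c_Y)_2) ((c_Y)_1)^ψ`, where
`∑ a_Y ⊗ c_Y = η(Y, Y)(id_Y)`. -/
def gammaPrime (η : W1 E) : dualTensorH E ⟶ hTensorC E where
  app Y :=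
    { hom := RightMod.homOf (M := ((dualTensorH E).obj Y).toMod)
        (N := ((hTensorC E).obj Y).toMod) (fun X => η.phi X Y)
        (fun g t => η.phi_act g t)
      colinear X t := η.phi_colinear t }
  naturality Y Z f := by
    ext X t
    exact η.phi_natural f t

end FiniteDimensional

/-- `(F, G)` is a Frobenius pair: `G` is both a right adjoint and a left adjoint of `F`. -/
def IsFrobeniusPair {A B : Type*} [Category* A] [Category* B] (F : A ⥤ B) (G : B ⥤ A) : Prop :=
  Nonempty (F ⊣ G) ∧ Nonempty (G ⊣ F)

end Entwining

end

/-!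
Write `F` for the functor forgetting the coaction and `G = - ⊗ C`. The functor `G` is always a
right adjoint of `F` (`forgetCofreeAdj`), so `(F, G)` is a Frobenius pair exactly when `G` is also
a left adjoint of `F`.

For `C` finite dimensional, the entwined module `C* ⊗ h_Y` represents `M ↦ Hom(h_Y, F(M)) = M(Y)`
with universal element `ε ⊗ id`. Uniqueness is `dualTensorH_hom_ext_counit`: since
`ρ(ε ⊗ id) = ∑ d_i* ⊗ id ⊗ d_i`, colinearity of a morphism `φ` gives back `φ(c* ⊗ id)` from
`φ(ε ⊗ id)`. If `G` is left adjoint to `F`, then `h_Y ⊗ C = G(h_Y)` represents the same functor,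
and comparing universal elements gives the isomorphism `isoOfAdj`.

The maps `γ'` and `α'` are surjective (`gammaPrime_counitTensor`, `alphaPrime_ofNatTrans`): a
transformation `Φ : C* ⊗ h ⟶ h ⊗ C` comes from `η(f) = Φ(ε ⊗ f)`, again by the universal property,
and `Υ : h ⊗ C ⟶ C* ⊗ h` comes from `θ_X(c ⊗ d) = Υ(id_X ⊗ d)(c)`. Hence an isomorphism
`C* ⊗ h ≅ h ⊗ C` and its inverse have the form `γ'(η)` and `α'(θ)`.

Finally, given `η` and `θ` with `Φ = γ'(η)` and `Υ = α'(θ)` mutually inverse, the unit and the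
counit of an adjunction `G ⊣ F` are

* `N ⟶ N ⊗ C`, `n ↦ ∑ n a_X ⊗ c_X` (`W1.insertTrans`), and
* `M ⊗ C ⟶ M`, `m ⊗ d ↦ m_0 θ_X(m_1 ⊗ d)` (`V1.contractTrans`).

The two triangle composites are `m ↦ m_0 · (Υ Φ (ε ⊗ id))(m_1)` and `n ⊗ c ↦ n · Φ Υ (id ⊗ c)`
(`contract_insert`, `contract_rTensor_insert`), so both identities hold.
-/

noncomputable section

namespace Entwining

variable {K : Type u} [Field K] {D : Type w} [Category.{u} D] [Preadditive D] [Linear K D]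
  {C : Type u} [AddCommGroup C] [Module K C] [Coalgebra K C]
  (E : EntwiningStructure K D C)

/-! ### The adjunction between the forgetful functor and `- ⊗ C` -/

/-- The map `n ⊗ c ↦ ε(c) n`. -/
def counitContract (K : Type u) [Field K] (C : Type u) [AddCommGroup C] [Module K C]
    [Coalgebra K C] (V : Type u) [AddCommGroup V] [Module K V] : V ⊗[K] C →ₗ[K] V :=
  (TensorProduct.rid K V).toLinearMap ∘ₗ (Coalgebra.counit (R := K) (A := C)).lTensor V

@[simp] lemma counitContract_tmul {V : Type u} [AddCommGroup V] [Module K V] (v : V) (c : C) :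
    counitContract K C V (v ⊗ₜ c) = Coalgebra.counit (R := K) c • v := by
  simp [counitContract]

lemma counitContract_rTensor {V W : Type u} [AddCommGroup V] [Module K V] [AddCommGroup W]
    [Module K W] (α : V →ₗ[K] W) (t : V ⊗[K] C) :
    counitContract K C W (α.rTensor C t) = α (counitContract K C V t) := by
  induction t with
  | zero => simp
  | add x y hx hy => simp only [map_add, hx, hy]
  | tmul v c => simp

lemma counitContract_twist {X Y : D} {V W : Type u} [AddCommGroup V] [Module K V]
    [AddCommGroup W] [Module K W] (B : (X ⟶ Y) →ₗ[K] V →ₗ[K] W) (f : X ⟶ Y) (t : V ⊗[K] C) :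
    counitContract K C W (E.twist B f t) = B f (counitContract K C V t) := by
  induction t with
  | zero => simp
  | add x y hx hy => simp only [map_add, hx, hy]
  | tmul v c =>
    rw [E.twist_tmul, counitContract_rTensor]
    have h := E.psi_counit f c
    change counitContract K C _ (E.ψ X Y (c ⊗ₜ f)) = _ at h
    simp [h]

lemma counitContract_rTensor_freeCoaction {V : Type u} [AddCommGroup V] [Module K V]
    (t : V ⊗[K] C) :
    (counitContract K C V).rTensor C ((freeCoaction K C V).ρ t) = t := by
  induction t with
  | zero => simp
  | add x y hx hy => simp only [map_add, hx, hy]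
  | tmul v c =>
    have key : ∀ s : C ⊗[K] C, (counitContract K C V).rTensor C
        ((TensorProduct.assoc K V C C).symm (v ⊗ₜ s)) =
        v ⊗ₜ TensorProduct.lid K C ((Coalgebra.counit (R := K) (A := C)).rTensor C s) := by
      intro s
      induction s with
      | zero => simp
      | add x y hx hy => simp only [map_add, tmul_add, hx, hy]
      | tmul a b => simp [smul_tmul]
    refine (key _).trans ?_
    rw [Coalgebra.rTensor_counit_comul]
    simp

lemma RightCoaction.rTensor_ρ {M : Type u} [AddCommGroup M] [Module K M]
    (R : RightCoaction K C M) (m : M) :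
    (freeCoaction K C M).ρ (R.ρ m) = R.ρ.rTensor C (R.ρ m) := by
  apply (TensorProduct.assoc K M C C).injective
  rw [R.coassoc]
  simp [freeCoaction]

/-- The functor `- ⊗ C` is right adjoint to the functor forgetting the coaction: the unit is
the coaction `M ⟶ M ⊗ C` and the counit is `id ⊗ ε`. -/
def forgetCofreeAdj : forgetCoaction E ⊣ cofree E :=
  Adjunction.mkOfUnitCounit
    { unit :=
        { app M :=
            { hom := RightMod.homOf (M := M.toMod) (N := (tensorC E M.toMod).toMod)
                (fun X => (M.coact X).ρ) (fun f m => M.compat f m)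
              colinear X m := (M.coact X).rTensor_ρ m }
          naturality M N φ := by
            ext X m
            exact φ.colinear X.unop m }
      counit :=
        { app N := RightMod.homOf (M := (tensorC E N).toMod) (N := N)
            (fun X => counitContract K C (N.at X)) (fun f t => counitContract_twist E N.act f t)
          naturality M N φ := by
            ext X t
            exact counitContract_rTensor (RightMod.app φ X.unop) t }
      left_triangle := by
        ext M X m
        exact (M.coact X.unop).counit m
      right_triangle := by
        ext N X t
        exact counitContract_rTensor_freeCoaction (V := N.at X.unop) t }

/-! ### Evaluating `C`-indexed families of morphisms -/

section Eval

variable {V W : Type u} [AddCommGroup V] [Module K V] [AddCommGroup W] [Module K W]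

/-- For an action `B : Hom(X, Y) × V → W` and `φ : C → Hom(X, Y)`, the map `V ⊗ C → W`,
`v ⊗ c ↦ B(φ(c), v)`. -/
def evalAct {X Y : D} (B : (X ⟶ Y) →ₗ[K] V →ₗ[K] W) (φ : C →ₗ[K] (X ⟶ Y)) :
    V ⊗[K] C →ₗ[K] W :=
  TensorProduct.lift (B.flip.compl₂ φ)

@[simp] lemma evalAct_tmul {X Y : D} (B : (X ⟶ Y) →ₗ[K] V →ₗ[K] W) (φ : C →ₗ[K] (X ⟶ Y))
    (v : V) (c : C) : evalAct B φ (v ⊗ₜ c) = B (φ c) v := rfl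

/-- For an action `B : Hom(X, Y) × V → W` and `Θ : C → Hom(X, Y) ⊗ C`, the map
`V ⊗ C → W ⊗ C` sending `v ⊗ c` to `∑ B(f_i, v) ⊗ c_i`, where `Θ(c) = ∑ f_i ⊗ c_i`. -/
def evalActC {X Y : D} (B : (X ⟶ Y) →ₗ[K] V →ₗ[K] W) (Θ : C →ₗ[K] (X ⟶ Y) ⊗[K] C) :
    V ⊗[K] C →ₗ[K] W ⊗[K] C :=
  TensorProduct.lift ((LinearMap.rTensorHom C ∘ₗ B.flip).compl₂ Θ)

@[simp] lemma evalActC_tmul {X Y : D} (B : (X ⟶ Y) →ₗ[K] V →ₗ[K] W)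
    (Θ : C →ₗ[K] (X ⟶ Y) ⊗[K] C) (v : V) (c : C) :
    evalActC B Θ (v ⊗ₜ c) = (B.flip v).rTensor C (Θ c) := rfl

lemma evalAct_add {X Y : D} (B : (X ⟶ Y) →ₗ[K] V →ₗ[K] W) (φ φ' : C →ₗ[K] (X ⟶ Y))
    (t : V ⊗[K] C) : evalAct B (φ + φ') t = evalAct B φ t + evalAct B φ' t := by
  have h : evalAct B (φ + φ') = evalAct B φ + evalAct B φ' := by
    ext v c
    simp
  rw [h, LinearMap.add_apply]

@[simp] lemma evalAct_zero {X Y : D} (B : (X ⟶ Y) →ₗ[K] V →ₗ[K] W) (t : V ⊗[K] C) :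
    evalAct B 0 t = 0 := by
  simpa using evalAct_add B 0 0 t

lemma evalActC_add {X Y : D} (B : (X ⟶ Y) →ₗ[K] V →ₗ[K] W) (Θ Θ' : C →ₗ[K] (X ⟶ Y) ⊗[K] C)
    (t : V ⊗[K] C) : evalActC B (Θ + Θ') t = evalActC B Θ t + evalActC B Θ' t := by
  have h : evalActC B (Θ + Θ') = evalActC B Θ + evalActC B Θ' := by
    ext v c
    simp
  rw [h, LinearMap.add_apply]

@[simp] lemma evalActC_zero {X Y : D} (B : (X ⟶ Y) →ₗ[K] V →ₗ[K] W) (t : V ⊗[K] C) :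
    evalActC B (0 : C →ₗ[K] (X ⟶ Y) ⊗[K] C) t = 0 := by
  simpa using evalActC_add B 0 0 t

/-- In `V ⊗ C` one has `v ⊗ c_1 ⊗ c_2 ↦ v φ(c_2)_ψ ⊗ (c_1)^ψ`. -/
lemma evalAct_freeCoaction {X Y : D} (B : (X ⟶ Y) →ₗ[K] V →ₗ[K] W) (φ : C →ₗ[K] (X ⟶ Y))
    (t : V ⊗[K] C) :
    evalAct (E.twist B) φ ((freeCoaction K C V).ρ t) = evalActC B (homRho E φ) t := by
  induction t with
  | zero => simp
  | add x y hx hy => simp only [map_add, hx, hy]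
  | tmul n c =>
    have key : ∀ s : C ⊗[K] C,
        evalAct (E.twist B) φ ((TensorProduct.assoc K V C C).symm (n ⊗ₜ s)) =
        (B.flip n).rTensor C (E.ψ X Y (φ.lTensor C s)) := by
      intro s
      induction s with
      | zero => simp
      | add x y hx hy => simp only [map_add, tmul_add, hx, hy]
      | tmul a b => exact E.twist_tmul B (φ b) n a
    exact key _

end Eval

lemma evalAct_twist (N : RightMod K D) {X Y Z : D} (φ : C →ₗ[K] (Z ⟶ X)) (f : X ⟶ Y)
    (t : N.at Y ⊗[K] C) :
    evalAct N.act φ (E.twist N.act f t) = evalAct N.act (leftHom E f φ) t := by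
  induction t with
  | zero => simp
  | add x y hx hy => simp only [map_add, hx, hy]
  | tmul n c =>
    rw [E.twist_tmul, evalAct_tmul, leftHom_apply]
    induction E.ψ X Y (c ⊗ₜ f) with
    | zero => simp
    | add x y hx hy => simp only [map_add, hx, hy, LinearMap.add_apply]
    | tmul g d => simp [N.act_comp]

lemma act_evalAct (N : RightMod K D) {X Y Z : D} (φ : C →ₗ[K] (X ⟶ Y)) (g : Z ⟶ X)
    (t : N.at Y ⊗[K] C) :
    N.act g (evalAct N.act φ t) = evalAct N.act (Linear.leftComp K Y g ∘ₗ φ) t := by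
  induction t with
  | zero => simp
  | add x y hx hy => simp only [map_add, hx, hy]
  | tmul n c => simp [N.act_comp]

lemma app_evalAct {M N : RightMod K D} (η : M ⟶ N) {X Y : D} (φ : C →ₗ[K] (X ⟶ Y))
    (t : M.at Y ⊗[K] C) :
    RightMod.app η X (evalAct M.act φ t) = evalAct N.act φ ((RightMod.app η Y).rTensor C t) := by
  induction t with
  | zero => simp
  | add x y hx hy => simp only [map_add, hx, hy]
  | tmul n c => exact RightMod.app_act η (φ c) n

/-- The coassociativity of `M` gives `ρ(m_0 φ(m_1)) = m_0 φ(m_2)_ψ ⊗ (m_1)^ψ`. -/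
lemma EntwinedModule.ρ_evalAct {E : EntwiningStructure K D C} (M : EntwinedModule E) {X Y : D}
    (φ : C →ₗ[K] (X ⟶ Y)) (m : M.toMod.at Y) :
    (M.coact X).ρ (evalAct M.toMod.act φ ((M.coact Y).ρ m)) =
      evalActC M.toMod.act (homRho E φ) ((M.coact Y).ρ m) := by
  -- `m ⊗ a ⊗ b ↦ m φ(b)_ψ ⊗ a^ψ`
  let G : M.toMod.at Y ⊗[K] (C ⊗[K] C) →ₗ[K] M.toMod.at X ⊗[K] C :=
    TensorProduct.lift ((LinearMap.rTensorHom C ∘ₗ M.toMod.act.flip).compl₂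
      (E.ψ X Y ∘ₗ φ.lTensor C))
  have h1 : ∀ (r : M.toMod.at Y ⊗[K] C) (c : C),
      E.twist M.toMod.act (φ c) r = G (TensorProduct.assoc K _ C C (r ⊗ₜ c)) := by
    intro r c
    induction r with
    | zero => simp
    | add x y hx hy => simp only [map_add, add_tmul, hx, hy]
    | tmul n a => rw [E.twist_tmul]; rfl
  have h2 : ∀ s : M.toMod.at Y ⊗[K] C, (M.coact X).ρ (evalAct M.toMod.act φ s) =
      G (TensorProduct.assoc K _ C C ((M.coact Y).ρ.rTensor C s)) := by
    intro s
    induction s with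
    | zero => simp
    | add x y hx hy => simp only [map_add, hx, hy]
    | tmul n c => rw [evalAct_tmul, M.compat, h1, LinearMap.rTensor_tmul]
  rw [h2, (M.coact Y).coassoc]
  induction (M.coact Y).ρ m with
  | zero => simp
  | add x y hx hy => simp only [map_add, hx, hy]
  | tmul n c => rfl

lemma evalActC_act {N : RightMod K D} {X Y Z : D} (Θ : C →ₗ[K] (X ⟶ Y) ⊗[K] C) (n : N.at Z)
    (u : (Y ⟶ Z) ⊗[K] C) :
    evalActC N.act Θ ((N.act.flip n).rTensor C u) = (N.act.flip n).rTensor C (absorb Θ u) := by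
  induction u with
  | zero => simp
  | add x y hx hy => simp only [map_add, hx, hy]
  | tmul b c =>
    rw [absorb_tmul, LinearMap.rTensor_tmul, evalActC_tmul, ← LinearMap.rTensor_comp_apply]
    congr 2
    ext f
    exact (N.act_comp f b n).symm

/-! ### Natural transformations out of `C* ⊗ h` -/

section FiniteDimensional

variable [FiniteDimensional K C]

lemma rid_lTensor_dual {V : Type u} [AddCommGroup V] [Module K V] (d : Module.Dual K V)
    (t : Module.Dual K C ⊗[K] V) :
    TensorProduct.rid K _ (d.lTensor _ t) = d ∘ₗ dualIso K C V t := by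
  induction t with
  | zero => ext; simp
  | add x y hx hy => simp only [map_add, hx, hy, LinearMap.comp_add]
  | tmul e y => ext x; simp [mul_comm]

/-- The component at `X` of a morphism of entwined modules out of `C* ⊗ h_Y`, with its source
written as a tensor product. -/
def dualApp {M : EntwinedModule E} {Y : D} (φ : (dualTensorH E).obj Y ⟶ M) (X : D) :
    Module.Dual K C ⊗[K] (X ⟶ Y) →ₗ[K] M.toMod.at X := RightMod.app φ.hom X

lemma dualApp_act {M : EntwinedModule E} {Y : D} (φ : (dualTensorH E).obj Y ⟶ M) {X Z : D}
    (f : Z ⟶ X) (t : Module.Dual K C ⊗[K] (X ⟶ Y)) :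
    dualApp E φ Z (comodAct _ Y f t) = M.toMod.act f (dualApp E φ X t) :=
  RightMod.app_act φ.hom f t

lemma dualApp_colinear {M : EntwinedModule E} {Y : D} (φ : (dualTensorH E).obj Y ⟶ M) {X : D}
    (t : Module.Dual K C ⊗[K] (X ⟶ Y)) :
    (M.coact X).ρ (dualApp E φ X t) =
      (dualApp E φ X).rTensor C (comodRho E (dualCoaction K C) Y X t) :=
  φ.colinear X t

lemma dualTensorH_hom_ext {M : EntwinedModule E} {Y : D} {φ φ' : (dualTensorH E).obj Y ⟶ M}
    (h : ∀ X d f, dualApp E φ X (d ⊗ₜ f) = dualApp E φ' X (d ⊗ₜ f)) : φ = φ' := by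
  ext X t
  exact LinearMap.congr_fun (TensorProduct.ext' (h X.unop)) t

/-- Colinearity reconstructs `φ(c* ⊗ f)` from `φ(ε ⊗ id)`, because
`ρ(ε ⊗ id) = ∑ d_i* ⊗ id ⊗ d_i` and `c* ⊗ id = ∑ c*(d_i) d_i* ⊗ id`. -/
lemma dualApp_tmul {M : EntwinedModule E} {Y : D} (φ : (dualTensorH E).obj Y ⟶ M)
    {X : D} (d : Module.Dual K C) (f : X ⟶ Y) :
    dualApp E φ X (d ⊗ₜ f) = M.toMod.act f (TensorProduct.rid K _ (d.lTensor _
      ((M.coact Y).ρ (dualApp E φ Y (Coalgebra.counit (R := K) (A := C) ⊗ₜ 𝟙 Y))))) := by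
  have hf : d ⊗ₜ[K] f = comodAct _ Y f (d ⊗ₜ[K] 𝟙 Y) := by simp
  have key : ∀ s : Module.Dual K C ⊗[K] C, TensorProduct.rid K _ (d.lTensor _
      ((dualApp E φ Y).rTensor C ((TensorProduct.assoc K _ (Y ⟶ Y) C).symm
        ((E.psiR (𝟙 Y)).lTensor _ s)))) =
      dualApp E φ Y (TensorProduct.rid K _ (d.lTensor _ s) ⊗ₜ[K] 𝟙 Y) := by
    intro s
    induction s with
    | zero => simp
    | add x y hx hy => simp only [map_add, add_tmul, hx, hy]
    | tmul e y =>
      rw [LinearMap.lTensor_tmul, E.psiR_apply, E.psi_id, assoc_symm_tmul,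
        LinearMap.rTensor_tmul, LinearMap.lTensor_tmul, LinearMap.lTensor_tmul, rid_tmul,
        rid_tmul, ← smul_tmul', map_smul]
  rw [hf, dualApp_act, dualApp_colinear, comodRho_tmul, key, rid_lTensor_dual, dualIso_rho]
  congr 4
  ext x
  simp [hit_apply]

/-- A morphism out of `C* ⊗ h_Y` is determined by its value at `ε ⊗ id`. -/
lemma dualTensorH_hom_ext_counit {M : EntwinedModule E} {Y : D}
    {φ φ' : (dualTensorH E).obj Y ⟶ M}
    (h : dualApp E φ Y (Coalgebra.counit (R := K) (A := C) ⊗ₜ 𝟙 Y) =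
      dualApp E φ' Y (Coalgebra.counit (R := K) (A := C) ⊗ₜ 𝟙 Y)) : φ = φ' :=
  dualTensorH_hom_ext E fun X d f => by
    rw [dualApp_tmul E φ, h, ← dualApp_tmul E φ']

lemma dualLeft_counit_tmul {X Y Z : D} (f : Y ⟶ Z) (g : X ⟶ Y) :
    dualLeft E f X (Coalgebra.counit (R := K) (A := C) ⊗ₜ g) =
      Coalgebra.counit (R := K) (A := C) ⊗ₜ (g ≫ f) := by
  apply (dualIso K C _).injective
  rw [dualIso_dualLeft]
  ext x
  have key : ∀ t : (Y ⟶ Z) ⊗[K] C, compo X Y Z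
      ((dualIso K C _ (Coalgebra.counit (R := K) (A := C) ⊗ₜ[K] g)).lTensor (Y ⟶ Z) t) =
      g ≫ TensorProduct.rid K (Y ⟶ Z)
        ((Coalgebra.counit (R := K) (A := C)).lTensor (Y ⟶ Z) t) := by
    intro t
    induction t with
    | zero => simp
    | add x y hx hy => simp only [map_add, hx, hy, Preadditive.comp_add]
    | tmul k c => simp
  rw [leftHom_apply, key, E.psi_counit]
  simp

/-- The natural transformation `h ⟶ F(C* ⊗ h)`, `f ↦ ε ⊗ f`. -/
def counitTensor : h K D ⟶ dualTensorH E ⋙ forgetCoaction E where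
  app Y := RightMod.homOf (M := (h K D).obj Y) (N := ((dualTensorH E).obj Y).toMod)
    (fun X => TensorProduct.mk K (Module.Dual K C) (X ⟶ Y) (Coalgebra.counit (R := K) (A := C)))
    (fun f g => rfl)
  naturality Y Z f := by
    ext X g
    exact (dualLeft_counit_tmul E f g).symm

lemma dualTensorH_hom_ext_counitTensor {M : EntwinedModule E} {Y : D}
    {φ φ' : (dualTensorH E).obj Y ⟶ M}
    (h : (counitTensor E).app Y ≫ (forgetCoaction E).map φ =
      (counitTensor E).app Y ≫ (forgetCoaction E).map φ') : φ = φ' :=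
  dualTensorH_hom_ext_counit E (congrArg (fun η => RightMod.app η Y (𝟙 Y)) h)

/-! ### The maps `γ'` and `α'` are surjective -/

lemma W1.phi_counit_tmul (η : W1 E) {X Y : D} (f : X ⟶ Y) :
    η.phi X Y (Coalgebra.counit (R := K) (A := C) ⊗ₜ f) = RightMod.app (η.app Y) X f := by
  have h1 : hit (Coalgebra.counit (R := K) (A := C)) = LinearMap.id := by
    ext x
    simp [hit_apply]
  rw [W1.phi_tmul, h1, LinearMap.lTensor_id]
  refine (RightMod.app_act (η.app Y) f (𝟙 Y)).symm.trans (congrArg _ ?_)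
  exact Category.comp_id f

/-- The natural transformation `η` is recovered from `Φ = γ'(η)` as `f ↦ Φ(ε ⊗ f)`. -/
lemma counitTensor_gammaPrime (η : W1 E) :
    counitTensor E ≫ Functor.whiskerRight (gammaPrime η) (forgetCoaction E) = η := by
  ext Y X f
  exact η.phi_counit_tmul E f

/-- Every natural transformation `C* ⊗ h ⟶ h ⊗ C` is `γ'(η)` for the `η` sending `f` to its
value at `ε ⊗ f`. -/
lemma gammaPrime_counitTensor (Φ : dualTensorH E ⟶ hTensorC E) :
    gammaPrime (counitTensor E ≫ Functor.whiskerRight Φ (forgetCoaction E)) = Φ := by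
  apply NatTrans.ext
  funext Y
  apply dualTensorH_hom_ext_counit
  exact W1.phi_counit_tmul E _ (𝟙 Y)

section Alpha

variable (Υ : hTensorC E ⟶ dualTensorH E)

/-- The component `h_Y(X) ⊗ C → C* ⊗ h_Y(X)` of a natural transformation. -/
def freeApp (X Y : D) : (X ⟶ Y) ⊗[K] C →ₗ[K] Module.Dual K C ⊗[K] (X ⟶ Y) :=
  RightMod.app (Υ.app Y).hom X

lemma freeApp_act {X Y Z : D} (g : Z ⟶ X) (t : (X ⟶ Y) ⊗[K] C) :
    freeApp E Υ Z Y (E.twist (Linear.comp Z X Y) g t) = comodAct _ Y g (freeApp E Υ X Y t) :=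
  RightMod.app_act (Υ.app Y).hom g t

lemma freeApp_colinear {X Y : D} (t : (X ⟶ Y) ⊗[K] C) :
    comodRho E (dualCoaction K C) Y X (freeApp E Υ X Y t) =
      (freeApp E Υ X Y).rTensor C ((freeCoaction K C (X ⟶ Y)).ρ t) :=
  (Υ.app Y).colinear X t

lemma freeApp_natural {X Y Z : D} (f : Y ⟶ Z) (t : (X ⟶ Y) ⊗[K] C) :
    freeApp E Υ X Z ((Linear.rightComp K X f).rTensor C t) =
      dualLeft E f X (freeApp E Υ X Y t) :=
  congrArg (fun φ : (hTensorC E).obj Y ⟶ (dualTensorH E).obj Z => RightMod.app φ.hom X t)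
    (Υ.naturality f)

lemma freeApp_tmul {X Y : D} (f : X ⟶ Y) (c : C) :
    freeApp E Υ X Y (f ⊗ₜ c) = dualLeft E f X (freeApp E Υ X X (𝟙 X ⊗ₜ c)) := by
  rw [← freeApp_natural, LinearMap.rTensor_tmul]
  congr 2
  exact (Category.id_comp f).symm

/-- The family `θ_X(c ⊗ d) = Υ(id_X ⊗ d)(c)`, where `C* ⊗ End(X)` is identified with
`Hom_K(C, End(X))`. -/
def thetaOf (X : D) : C ⊗[K] C →ₗ[K] (X ⟶ X) :=
  TensorProduct.lift ((dualIso K C (X ⟶ X)).toLinearMap ∘ₗ freeApp E Υ X X ∘ₗ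
    TensorProduct.mk K (X ⟶ X) C (𝟙 X)).flip

lemma thetaOf_tmul (X : D) (c d : C) :
    thetaOf E Υ X (c ⊗ₜ d) = dualIso K C _ (freeApp E Υ X X (𝟙 X ⊗ₜ d)) c := rfl

/-- The element of `V₁` whose image under `α'` is a given natural transformation. The first
condition on `V₁` expresses `D`-linearity and naturality of `Υ`, the second one colinearity. -/
def V1.ofNatTrans : V1 E where
  θ := thetaOf E Υ
  theta_comp {X Y} f c d := by
    have h1 : f ≫ thetaOf E Υ X (c ⊗ₜ d) =
        dualIso K C _ (freeApp E Υ Y X (E.ψ Y X (d ⊗ₜ f))) c := by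
      have h2 : E.twist (Linear.comp Y X X) f (𝟙 X ⊗ₜ d) = E.ψ Y X (d ⊗ₜ f) := by
        have h3 : (Linear.comp (S := K) Y X X).flip (𝟙 X) = LinearMap.id := by
          ext g
          simp
        rw [E.twist_tmul, h3, LinearMap.rTensor_id_apply]
      rw [← h2, freeApp_act, thetaOf_tmul]
      exact (LinearMap.congr_fun (dualIso_lTensor (Linear.leftComp K X f) _) c).symm
    rw [h1]
    induction E.ψ Y X (d ⊗ₜ f) with
    | zero => simp
    | add x y hx hy => simp only [map_add, LinearMap.add_apply, hx, hy]
    | tmul g e =>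
      rw [freeApp_tmul, dualIso_dualLeft, leftHom_apply, LinearMap.rTensor_tmul,
        LinearMap.comp_apply, TensorProduct.mk_apply]
      induction E.ψ Y X (c ⊗ₜ g) with
      | zero => simp
      | add x y hx hy => simp only [map_add, add_tmul, hx, hy]
      | tmul k l => simp [thetaOf_tmul]
  theta_comul X c d := by
    have h1 : ∀ s : C ⊗[K] C,
        (thetaOf E Υ X).lTensor C (TensorProduct.assoc K C C C (s ⊗ₜ d)) =
        (dualIso K C _ (freeApp E Υ X X (𝟙 X ⊗ₜ d))).lTensor C s := by
      intro s
      induction s with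
      | zero => simp
      | add x y hx hy => simp only [map_add, add_tmul, hx, hy]
      | tmul a b => simp [thetaOf_tmul]
    have h2 : ∀ s : C ⊗[K] C, dualIso K C _ (TensorProduct.assoc K _ _ C
        ((freeApp E Υ X X).rTensor C ((TensorProduct.assoc K _ C C).symm (𝟙 X ⊗ₜ s)))) c =
        (thetaOf E Υ X).rTensor C ((TensorProduct.assoc K C C C).symm (c ⊗ₜ s)) := by
      intro s
      induction s with
      | zero => simp
      | add x y hx hy => simp only [map_add, tmul_add, LinearMap.add_apply, hx, hy]
      | tmul a b =>
        rw [assoc_symm_tmul, LinearMap.rTensor_tmul, dualIso_assoc_tmul]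
        simp [thetaOf_tmul]
    rw [h1, ← homRho_apply, ← dualIso_comodRho, freeApp_colinear]
    exact (h2 _).symm

lemma alphaPrime_ofNatTrans : alphaPrime (V1.ofNatTrans E Υ) = Υ := by
  have key : ∀ X Y, (V1.ofNatTrans E Υ).upsilon X Y = freeApp E Υ X Y := by
    intro X Y
    refine TensorProduct.ext' fun f c => (dualIso K C _).injective ?_
    rw [V1.dualIso_upsilon, V1.upsilonHom_tmul, freeApp_tmul, dualIso_dualLeft]
    rfl
  ext Y X t
  exact LinearMap.congr_fun (key X.unop Y) t

end Alpha

/-! ### From a Frobenius pair to an isomorphism -/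

variable {E} in
/-- The element of `W₁` given by the unit of an adjunction between `- ⊗ C` and the forgetful
functor. -/
def W1.ofUnit (adj : cofree E ⊣ forgetCoaction E) : W1 E where
  app Y := adj.unit.app ((h K D).obj Y)
  naturality _ _ f := adj.unit.naturality ((h K D).map f)

/-- A left adjoint of the forgetful functor applied to `h_Y`, and `C* ⊗ h_Y`, both represent
`M ↦ Hom(h_Y, F(M))`: the universal elements are the unit of the adjunction and `ε ⊗ id`. -/
def isoOfAdj (adj : cofree E ⊣ forgetCoaction E) : dualTensorH E ≅ hTensorC E :=
  have hu (Y : D) : (counitTensor E).app Y ≫ (forgetCoaction E).map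
      ((gammaPrime (W1.ofUnit adj)).app Y) = adj.unit.app ((h K D).obj Y) :=
    congr_app (counitTensor_gammaPrime E (W1.ofUnit adj)) Y
  NatIso.ofComponents
    (fun Y =>
      { hom := (gammaPrime (W1.ofUnit adj)).app Y
        inv := (adj.homEquiv ((h K D).obj Y) ((dualTensorH E).obj Y)).symm
          ((counitTensor E).app Y)
        hom_inv_id := by
          apply dualTensorH_hom_ext_counitTensor
          refine (_ ≫= (forgetCoaction E).map_comp _ _).trans ?_
          refine (Category.assoc _ _ _).symm.trans ?_
          refine (hu Y =≫ _).trans ?_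
          exact (adj.homEquiv_unit _ _ _).symm.trans
            ((Equiv.apply_symm_apply _ _).trans (Category.comp_id _).symm)
        inv_hom_id := by
          refine (adj.homEquiv_naturality_right_symm _ _).symm.trans ?_
          refine (Equiv.symm_apply_eq _).2 ?_
          exact (hu Y).trans (adj.homEquiv_id _).symm })
    (fun f => (gammaPrime (W1.ofUnit adj)).naturality f)

/-! ### From inverse transformations to a Frobenius pair -/

variable {E}

/-- The map `M(X) ⊗ C → M(X)`, `m ⊗ d ↦ M(θ_X(m_1 ⊗ d))(m_0)`. -/
def V1.contract (θ : V1 E) (M : EntwinedModule E) (X : D) :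
    M.toMod.at X ⊗[K] C →ₗ[K] M.toMod.at X :=
  TensorProduct.lift M.toMod.act.flip ∘ₗ (θ.θ X).lTensor _ ∘ₗ
    (TensorProduct.assoc K _ C C).toLinearMap ∘ₗ (M.coact X).ρ.rTensor C

lemma V1.contract_tmul (θ : V1 E) (M : EntwinedModule E) {X : D} (m : M.toMod.at X) (d : C) :
    θ.contract M X (m ⊗ₜ d) =
      evalAct M.toMod.act ((TensorProduct.curry (θ.θ X)).flip d) ((M.coact X).ρ m) := by
  simp only [contract, LinearMap.comp_apply, LinearMap.rTensor_tmul, LinearEquiv.coe_coe]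
  induction (M.coact X).ρ m with
  | zero => simp
  | add x y hx hy => simp only [map_add, add_tmul, hx, hy]
  | tmul n c => simp

lemma V1.contract_act_tmul (θ : V1 E) (M : EntwinedModule E) {X Y : D} (m : M.toMod.at Y)
    (u : (X ⟶ Y) ⊗[K] C) :
    θ.contract M X ((M.toMod.act.flip m).rTensor C u) =
      evalAct M.toMod.act (θ.upsilonHom X Y u) ((M.coact Y).ρ m) := by
  induction u with
  | zero => simp
  | add x y hx hy => simp only [map_add, hx, hy, evalAct_add]
  | tmul g e =>
    rw [LinearMap.rTensor_tmul, contract_tmul, LinearMap.flip_apply, M.compat, evalAct_twist,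
      upsilonHom_tmul]

lemma V1.contract_twist (θ : V1 E) (M : EntwinedModule E) {X Y : D} (f : X ⟶ Y)
    (t : M.toMod.at Y ⊗[K] C) :
    θ.contract M X (E.twist M.toMod.act f t) = M.toMod.act f (θ.contract M Y t) := by
  induction t with
  | zero => simp
  | add x y hx hy => simp only [map_add, hx, hy]
  | tmul m d =>
    rw [E.twist_tmul, contract_act_tmul, contract_tmul, act_evalAct, leftComp_theta]

lemma V1.contract_colinear (θ : V1 E) (M : EntwinedModule E) {X : D}
    (t : M.toMod.at X ⊗[K] C) :
    (M.coact X).ρ (θ.contract M X t) =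
      (θ.contract M X).rTensor C ((freeCoaction K C (M.toMod.at X)).ρ t) := by
  induction t with
  | zero => simp
  | add x y hx hy => simp only [map_add, hx, hy]
  | tmul m d =>
    have h1 : homRho E ((TensorProduct.curry (θ.θ X)).flip d) =
        ((θ.θ X).rTensor C ∘ₗ (TensorProduct.assoc K C C C).symm.toLinearMap) ∘ₗ
          (TensorProduct.mk K C (C ⊗[K] C)).flip (Coalgebra.comul (R := K) d) := by
      ext y
      refine Eq.trans ?_ (θ.theta_comul X y d).symm
      rw [homRho_apply]
      congr 1
      induction Coalgebra.comul (R := K) y with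
      | zero => simp
      | add x y hx hy => simp only [map_add, add_tmul, hx, hy]
      | tmul l m => simp
    have h2 : ∀ s : C ⊗[K] C, evalActC M.toMod.act
        (((θ.θ X).rTensor C ∘ₗ (TensorProduct.assoc K C C C).symm.toLinearMap) ∘ₗ
          (TensorProduct.mk K C (C ⊗[K] C)).flip s) ((M.coact X).ρ m) =
        (θ.contract M X).rTensor C ((TensorProduct.assoc K _ C C).symm (m ⊗ₜ s)) := by
      intro s
      induction s with
      | zero => simp
      | add x y hx hy =>
        simp only [map_add, tmul_add, LinearMap.comp_add, evalActC_add, hx, hy]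
      | tmul a b =>
        rw [assoc_symm_tmul, LinearMap.rTensor_tmul, contract_tmul]
        induction (M.coact X).ρ m with
        | zero => simp
        | add x y hx hy => simp only [map_add, add_tmul, hx, hy]
        | tmul n c => simp
    rw [contract_tmul, M.ρ_evalAct, h1, h2]
    rfl

lemma V1.contract_natural (θ : V1 E) {M N : EntwinedModule E} (φ : M ⟶ N) {X : D}
    (t : M.toMod.at X ⊗[K] C) :
    θ.contract N X ((RightMod.app φ.hom X).rTensor C t) =
      RightMod.app φ.hom X (θ.contract M X t) := by
  induction t with
  | zero => simp
  | add x y hx hy => simp only [map_add, hx, hy]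
  | tmul m d =>
    rw [LinearMap.rTensor_tmul, contract_tmul, contract_tmul, app_evalAct, φ.colinear]

/-- The counit `M ⊗ C ⟶ M`, `m ⊗ d ↦ M(θ(m_1 ⊗ d))(m_0)`. -/
def V1.contractTrans (θ : V1 E) : forgetCoaction E ⋙ cofree E ⟶ 𝟭 (EntwinedModule E) where
  app M :=
    { hom := RightMod.homOf (M := (tensorC E M.toMod).toMod) (N := M.toMod)
        (fun X => θ.contract M X) (fun f t => θ.contract_twist M f t)
      colinear X t := θ.contract_colinear M t }
  naturality M N φ := by
    ext X t
    exact θ.contract_natural φ t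

/-- The map `N(X) → N(X) ⊗ C`, `n ↦ ∑ N(a_X)(n) ⊗ c_X`. -/
def W1.insert (η : W1 E) (N : RightMod K D) (X : D) : N.at X →ₗ[K] N.at X ⊗[K] C :=
  ((LinearMap.rTensorHom C ∘ₗ N.act.flip).flip (η.unit X))

lemma W1.insert_apply (η : W1 E) (N : RightMod K D) {X : D} (n : N.at X) :
    η.insert N X n = (N.act.flip n).rTensor C (η.unit X) := rfl

lemma W1.insert_act (η : W1 E) (N : RightMod K D) {X Y : D} (f : X ⟶ Y) (n : N.at Y) :
    η.insert N X (N.act f n) = E.twist N.act f (η.insert N Y n) := by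
  have h1 : N.act.flip (N.act f n) = N.act.flip n ∘ₗ Linear.rightComp K X f := by
    ext g
    exact (N.act_comp g f n).symm
  rw [insert_apply, h1, LinearMap.rTensor_comp_apply, ← twist_unit]
  exact E.twist_natural _ _ _ _ (fun g k => N.act_comp g k n) f _

lemma W1.insert_natural (η : W1 E) {M N : RightMod K D} (φ : M ⟶ N) {X : D} (m : M.at X) :
    η.insert N X (RightMod.app φ X m) = (RightMod.app φ X).rTensor C (η.insert M X m) := by
  rw [insert_apply, insert_apply, ← LinearMap.rTensor_comp_apply]
  congr 2
  ext g
  exact (RightMod.app_act φ g m).symm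

/-- The unit `N ⟶ N ⊗ C`, `n ↦ ∑ N(a_X)(n) ⊗ c_X`. -/
def W1.insertTrans (η : W1 E) : 𝟭 (RightMod K D) ⟶ cofree E ⋙ forgetCoaction E where
  app N := RightMod.homOf (M := N) (N := (tensorC E N).toMod) (fun X => η.insert N X)
    (fun f n => η.insert_act N f n)
  naturality M N φ := by
    ext X m
    exact η.insert_natural φ m

/-- The triangle identity at an entwined module `M`: the composite is
`m ↦ m_0 · Υ(Φ(ε ⊗ id))(m_1)`, and `Υ(Φ(ε ⊗ id)) = ε ⊗ id`. -/
lemma contract_insert {η : W1 E} {θ : V1 E} {X : D}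
    (hη : ∀ t, θ.upsilon X X (η.phi X X t) = t) (M : EntwinedModule E) (m : M.toMod.at X) :
    θ.contract M X (η.insert M.toMod X m) = m := by
  have h1 : η.phi X X (Coalgebra.counit (R := K) (A := C) ⊗ₜ 𝟙 X) = η.unit X :=
    η.phi_counit_tmul E (𝟙 X)
  rw [W1.insert_apply, V1.contract_act_tmul, ← h1, ← V1.dualIso_upsilon, hη]
  refine Eq.trans ?_ ((M.coact X).counit m)
  induction (M.coact X).ρ m with
  | zero => simp
  | add x y hx hy => simp only [map_add, hx, hy]
  | tmul n c => simp [M.toMod.act_id]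

/-- The triangle identity at `N ⊗ C`: the composite is `n ⊗ c ↦ n · Φ(Υ(id ⊗ c))`, and
`Φ(Υ(id ⊗ c)) = id ⊗ c`. -/
lemma contract_rTensor_insert {η : W1 E} {θ : V1 E} {X : D}
    (hη : ∀ t, η.phi X X (θ.upsilon X X t) = t) (N : RightMod K D) (t : N.at X ⊗[K] C) :
    θ.contract (tensorC E N) X ((η.insert N X).rTensor C t) = t := by
  let L : (N.at X ⊗[K] C) ⊗[K] C →ₗ[K] N.at X ⊗[K] C := θ.contract (tensorC E N) X
  have hL : L ∘ₗ (η.insert N X).rTensor C = LinearMap.id := by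
    refine TensorProduct.ext' fun n c => ?_
    have h1 : absorb (homRho E ((TensorProduct.curry (θ.θ X)).flip c)) (η.unit X) =
        𝟙 X ⊗ₜ c := by
      rw [← hη (𝟙 X ⊗ₜ c), W1.phi_eq_absorb, V1.dualIso_upsilon, V1.upsilonHom_tmul, leftHom_id]
    refine (θ.contract_tmul (tensorC E N) (η.insert N X n) c).trans
      ((evalAct_freeCoaction E N.act _ _).trans ?_)
    rw [W1.insert_apply, evalActC_act, h1]
    simp [N.act_id]
  exact LinearMap.congr_fun hL t

/-- If `γ'(η)` and `α'(θ)` are mutually inverse, then `- ⊗ C` is left adjoint to the functor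
forgetting the coaction. -/
def adjOfInverse {η : W1 E} {θ : V1 E} (h1 : gammaPrime η ≫ alphaPrime θ = 𝟙 (dualTensorH E))
    (h2 : alphaPrime θ ≫ gammaPrime η = 𝟙 (hTensorC E)) : cofree E ⊣ forgetCoaction E :=
  Adjunction.mkOfUnitCounit
    { unit := η.insertTrans
      counit := θ.contractTrans
      left_triangle := by
        ext N X t
        exact contract_rTensor_insert (X := X.unop) (fun t => congrArg
          (fun φ : hTensorC E ⟶ hTensorC E => RightMod.app (φ.app X.unop).hom X.unop t) h2) N t
      right_triangle := by
        ext M X m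
        exact contract_insert (X := X.unop) (fun t => congrArg
          (fun φ : dualTensorH E ⟶ dualTensorH E =>
            RightMod.app (φ.app X.unop).hom X.unop t) h1) M m }

end FiniteDimensional

end Entwining

end

theorem theorem3p22 {K : Type u} [Field K] {D : Type w} [CategoryTheory.Category.{u} D]
    [CategoryTheory.Preadditive D] [CategoryTheory.Linear K D]
    {C : Type u} [AddCommGroup C] [Module K C] [Coalgebra K C] [FiniteDimensional K C]
    (E : Entwining.EntwiningStructure K D C) :
    List.TFAE
      [Entwining.IsFrobeniusPair (Entwining.forgetCoaction E) (Entwining.cofree E),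
        ∃ (η : Entwining.W1 E) (θ : Entwining.V1 E),
          Entwining.gammaPrime η ≫ Entwining.alphaPrime θ = 𝟙 (Entwining.dualTensorH E) ∧
            Entwining.alphaPrime θ ≫ Entwining.gammaPrime η = 𝟙 (Entwining.hTensorC E),
        Nonempty (Entwining.dualTensorH E ≅ Entwining.hTensorC E)] := by
  tfae_have 1 → 3 := fun ⟨_, ⟨adj⟩⟩ => ⟨Entwining.isoOfAdj E adj⟩
  tfae_have 3 → 2 := fun ⟨i⟩ => by
    refine ⟨Entwining.counitTensor E ≫ Functor.whiskerRight i.hom (Entwining.forgetCoaction E),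
      Entwining.V1.ofNatTrans E i.inv, ?_⟩
    rw [Entwining.gammaPrime_counitTensor, Entwining.alphaPrime_ofNatTrans]
    exact ⟨i.hom_inv_id, i.inv_hom_id⟩
  tfae_have 2 → 1 := fun ⟨_, _, h1, h2⟩ =>
    ⟨⟨Entwining.forgetCofreeAdj E⟩, ⟨Entwining.adjOfInverse h1 h2⟩⟩
  tfae_finish
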